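/- Let $\Bbbk$ be a commutative ring (for instance $\mathbb{Z}$ or a field) and $n\ge 0$. **The algebras.** The nilHecke algebra $\mathrm{nh}_n$ is the $\Bbbk$-algebra with generators $x_1,\dots,x_n$, $T_1,\dots,T_{n-1}$ and relations $x_ix_j=x_jx_i$; $T_i^2=0$; $T_iT_j=T_jT_i$ if $|i-j|>1$; $T_iT_{i+1}T_i=T_{i+1}T_iT_{i+1}$; $x_iT_j=T_jx_i$ if $i\ne j,j+1$; $x_iT_i-T_ix_{i+1}=1=T_ix_i-x_{i+1}T_i$. The enhanced nilHecke algebra $A_n$ has the generators and relations of $\mathrm{nh}_n$ and further generators $\omega_1,\dots,\omega_n$ with $\omega_i^2=0$; $\omega_i\omega_j=-\omega_j\omega_i$; $x_i\omega_j=\omega_jx_i$; $T_i\omega_j=\omega_jT_i$ if $i\neq j$; $T_i(\omega_i-x_{i+1}\omega_{i+1})=(\omega_i-x_{i+1}\omega_{i+1})T_i$. The $\lambda$-degree is $0$ on the $x_i$ and $T_i$ and $2$ on the $\omega_i$; $A_n^{2m}$ is the span of the elements of $\lambda$-degree $2m$. Elements of $\mathrm{nh}_n$ act on $A_n$ by multiplication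 through the canonical map $\mathrm{nh}_n\to A_n$. **The $\mathfrak{sl}_2$-actions.** For $1\le r,i\le n$ put $\partial_r\omega_i=\sum_{j=i+1}^{r}\bigl(\prod_{k=i+1}^{j-1}(x_k-x_r)\bigr)\omega_j$ (which is $0$ if $r\le i$). Let $\mathfrak{sl}_2=\mathfrak{sl}_2(\Bbbk)$, with standard basis $e,f,h$, act on $A_n$ by derivations with $$e(x_i)=x_i^2,\quad f(x_i)=-1,\quad h(x_i)=2x_i,$$ $$e(\omega_i)=\sum_{r=1}^n x_r^2\,\partial_r\omega_i,\quad f(\omega_i)=-\sum_{r=1}^n\partial_r\omega_i,\quad h(\omega_i)=2\sum_{r=1}^n x_r\,\partial_r\omega_i,$$ $$e(T_i)=1-2x_iT_i,\quad f(T_i)=0,\quad h(T_i)=-2T_i,$$ and on $\mathrm{nh}_n$ by derivations with the same values on the $x_i$ and $T_i$ (the Elias–Qi action). **The filtration.** For $0\le m\le n$ let $\underline\omega_1<\dots<\underline\omega_{\binom nm}$ be the monomials $\omega_{i_1}\cdots\omega_{i_m}$ with $i_1<\dots<i_m$, in lexicographic order of $(i_1,\dots,i_m)$. Let $A_n^{2m}(\ge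 j)\subseteq A_n$ be the $\mathfrak{sl}_2$-submodule generated by all products $a\,\underline\omega_r\,b$ with $a,b\in\mathrm{nh}_n$ and $r\ge j$. Let $\underline\omega_s\mathrm{nh}_n=\underline\omega_s\Bbbk\otimes_{\Bbbk}\mathrm{nh}_n$, where $\underline\omega_s\Bbbk$ is the free rank-one $\Bbbk$-module spanned by $\underline\omega_s$ in the exterior algebra on $\omega_1,\dots,\omega_n$, with trivial $\mathfrak{sl}_2$-action. **Proposition 4.2.** The values above define a unique action of the Lie algebra $\mathfrak{sl}_2$ by derivations on $\mathrm{nh}_n$ and a unique one on $A_n$. For every $0\le m\le n$, $A_n^{2m}$ is an $\mathfrak{sl}_2$-submodule of $A_n$, and $A_n^{2m}(\ge j)$ is the $\Bbbk$-span of the elements $\underline\omega_r b$ with $r\ge j$, $b\in\mathrm{nh}_n$. There is a filtration by $\mathfrak{sl}_2$-submodules $$0=A_n^{2m}\bigl(\ge\tbinom nm+1\bigr)\subseteq A_n^{2m}\bigl(\ge\tbinom nm\bigr)\subseteq\dots\subseteq A_n^{2m}(\ge 1)=A_n^{2m},$$ and for every $1\le s\le\binom nm$ there is an isomorphism of $\mathfrak{sl}_2$-modules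 $$A_n^{2m}(\ge s)\,/\,A_n^{2m}(\ge s+1)\;\cong\;\underline\omega_s\mathrm{nh}_n .$$ -/

import Mathlib

open scoped TensorProduct

attribute [local instance] LieRing.ofAssociativeRing

namespace EnhancedNilHecke

/-! ### The nilHecke algebra -/

/-- Generators of the nilHecke algebra. The index set `{1, …, n}` is `Fin n = {0, …, n - 1}`, and
`T i` is the crossing of the strands `i` and `i + 1`. -/
inductive NHGen (n : ℕ) : Type
  | x (i : Fin n) : NHGen n
  | T (i : ℕ) (h : i + 1 < n) : NHGen n

/-- The defining relations of the nilHecke algebra. -/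
inductive NHRel (k : Type*) [CommRing k] (n : ℕ) :
    FreeAlgebra k (NHGen n) → FreeAlgebra k (NHGen n) → Prop
  | x_comm (i j : Fin n) :
      NHRel k n (FreeAlgebra.ι k (.x i) * FreeAlgebra.ι k (.x j))
        (FreeAlgebra.ι k (.x j) * FreeAlgebra.ι k (.x i))
  | T_sq (i : ℕ) (h : i + 1 < n) :
      NHRel k n (FreeAlgebra.ι k (.T i h) * FreeAlgebra.ι k (.T i h)) 0
  | T_comm (i j : ℕ) (hi : i + 1 < n) (hj : j + 1 < n) (hij : i + 1 < j ∨ j + 1 < i) :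
      NHRel k n (FreeAlgebra.ι k (.T i hi) * FreeAlgebra.ι k (.T j hj))
        (FreeAlgebra.ι k (.T j hj) * FreeAlgebra.ι k (.T i hi))
  | braid (i : ℕ) (hi : i + 1 < n) (hi' : i + 1 + 1 < n) :
      NHRel k n
        (FreeAlgebra.ι k (.T i hi) * FreeAlgebra.ι k (.T (i + 1) hi') * FreeAlgebra.ι k (.T i hi))
        (FreeAlgebra.ι k (.T (i + 1) hi') * FreeAlgebra.ι k (.T i hi) *
          FreeAlgebra.ι k (.T (i + 1) hi'))
  | x_T_comm (i : Fin n) (j : ℕ) (hj : j + 1 < n) (h : (i : ℕ) ≠ j) (h' : (i : ℕ) ≠ j + 1) :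
      NHRel k n (FreeAlgebra.ι k (.x i) * FreeAlgebra.ι k (.T j hj))
        (FreeAlgebra.ι k (.T j hj) * FreeAlgebra.ι k (.x i))
  | x_T (i : ℕ) (h : i + 1 < n) :
      NHRel k n
        (FreeAlgebra.ι k (.x ⟨i, Nat.lt_of_succ_lt h⟩) * FreeAlgebra.ι k (.T i h) -
          FreeAlgebra.ι k (.T i h) * FreeAlgebra.ι k (.x ⟨i + 1, h⟩)) 1
  | T_x (i : ℕ) (h : i + 1 < n) :
      NHRel k n
        (FreeAlgebra.ι k (.T i h) * FreeAlgebra.ι k (.x ⟨i, Nat.lt_of_succ_lt h⟩) -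
          FreeAlgebra.ι k (.x ⟨i + 1, h⟩) * FreeAlgebra.ι k (.T i h)) 1

/-- The nilHecke algebra `nh_n` over `k`. -/
abbrev NilHecke (k : Type*) [CommRing k] (n : ℕ) : Type _ := RingQuot (NHRel k n)

/-- The image of a generator in `nh_n`. -/
noncomputable def nhGen (k : Type*) [CommRing k] (n : ℕ) (g : NHGen n) : NilHecke k n :=
  RingQuot.mkAlgHom k (NHRel k n) (FreeAlgebra.ι k g)

/-! ### The enhanced nilHecke algebra -/

/-- Generators of the enhanced nilHecke algebra: those of `nh_n` (`Sum.inl`), and the odd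
generators `ω_i` (`Sum.inr`). -/
abbrev EGen (n : ℕ) : Type := NHGen n ⊕ Fin n

/-- The defining relations of the enhanced nilHecke algebra. -/
inductive ERel (k : Type*) [CommRing k] (n : ℕ) :
    FreeAlgebra k (EGen n) → FreeAlgebra k (EGen n) → Prop
  | nh {a b : FreeAlgebra k (NHGen n)} (h : NHRel k n a b) :
      ERel k n (FreeAlgebra.lift k (fun g => FreeAlgebra.ι k (Sum.inl g : EGen n)) a)
        (FreeAlgebra.lift k (fun g => FreeAlgebra.ι k (Sum.inl g : EGen n)) b)
  | omega_sq (i : Fin n) :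
      ERel k n (FreeAlgebra.ι k (.inr i) * FreeAlgebra.ι k (.inr i)) 0
  | omega_anticomm (i j : Fin n) :
      ERel k n (FreeAlgebra.ι k (.inr i) * FreeAlgebra.ι k (.inr j))
        (-(FreeAlgebra.ι k (.inr j) * FreeAlgebra.ι k (.inr i)))
  | x_omega (i j : Fin n) :
      ERel k n (FreeAlgebra.ι k (.inl (.x i)) * FreeAlgebra.ι k (.inr j))
        (FreeAlgebra.ι k (.inr j) * FreeAlgebra.ι k (.inl (.x i)))
  | T_omega (i : ℕ) (hi : i + 1 < n) (j : Fin n) (hij : i ≠ (j : ℕ)) :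
      ERel k n (FreeAlgebra.ι k (.inl (.T i hi)) * FreeAlgebra.ι k (.inr j))
        (FreeAlgebra.ι k (.inr j) * FreeAlgebra.ι k (.inl (.T i hi)))
  | T_omega_self (i : ℕ) (h : i + 1 < n) :
      ERel k n
        (FreeAlgebra.ι k (.inl (.T i h)) *
          (FreeAlgebra.ι k (.inr ⟨i, Nat.lt_of_succ_lt h⟩) -
            FreeAlgebra.ι k (.inl (.x ⟨i + 1, h⟩)) * FreeAlgebra.ι k (.inr ⟨i + 1, h⟩)))
        ((FreeAlgebra.ι k (.inr ⟨i, Nat.lt_of_succ_lt h⟩) -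
            FreeAlgebra.ι k (.inl (.x ⟨i + 1, h⟩)) * FreeAlgebra.ι k (.inr ⟨i + 1, h⟩)) *
          FreeAlgebra.ι k (.inl (.T i h)))

/-- The enhanced nilHecke algebra `A_n` over `k`. -/
abbrev Enhanced (k : Type*) [CommRing k] (n : ℕ) : Type _ := RingQuot (ERel k n)

/-- The image of a generator in `A_n`. -/
noncomputable def eGen (k : Type*) [CommRing k] (n : ℕ) (g : EGen n) : Enhanced k n :=
  RingQuot.mkAlgHom k (ERel k n) (FreeAlgebra.ι k g)

/-- `x_i` as an element of `A_n`. -/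
noncomputable def xA (k : Type*) [CommRing k] {n : ℕ} (i : Fin n) : Enhanced k n :=
  eGen k n (.inl (.x i))

/-- `T_i` as an element of `A_n`. -/
noncomputable def TA (k : Type*) [CommRing k] {n : ℕ} (i : ℕ) (h : i + 1 < n) : Enhanced k n :=
  eGen k n (.inl (.T i h))

/-- `ω_i` as an element of `A_n`. -/
noncomputable def omegaA (k : Type*) [CommRing k] {n : ℕ} (i : Fin n) : Enhanced k n :=
  eGen k n (.inr i)

/-- The canonical homomorphism `nh_n → A_n`, `x_i ↦ x_i`, `T_i ↦ T_i`. -/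
noncomputable def nhToEnhanced (k : Type*) [CommRing k] (n : ℕ) :
    NilHecke k n →ₐ[k] Enhanced k n :=
  RingQuot.liftAlgHom k
    ⟨(RingQuot.mkAlgHom k (ERel k n)).comp
        (FreeAlgebra.lift k (fun g => FreeAlgebra.ι k (Sum.inl g : EGen n))),
      by
        intro a b h
        rw [AlgHom.comp_apply, AlgHom.comp_apply]
        exact RingQuot.mkAlgHom_rel k (ERel.nh h)⟩

theorem nhToEnhanced_nhGen (k : Type*) [CommRing k] (n : ℕ) (g : NHGen n) :
    nhToEnhanced k n (nhGen k n g) = eGen k n (.inl g) := by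
  unfold nhToEnhanced nhGen eGen
  rw [RingQuot.liftAlgHom_mkAlgHom_apply, AlgHom.comp_apply, FreeAlgebra.lift_ι_apply]

/-- The piece `A_n^{2m}` of `λ`-degree `2m`: `x_i` and `T_i` have `λ`-degree `0` and `ω_i` has
`λ`-degree `2`, so it is spanned by the words in the generators with exactly `m` letters `ω`. -/
noncomputable def lambdaPiece (k : Type*) [CommRing k] (n m : ℕ) : Submodule k (Enhanced k n) :=
  Submodule.span k
    {a | ∃ l : List (EGen n), l.countP Sum.isRight = m ∧ (l.map (eGen k n)).prod = a}

/-! ### The action of `sl_2` -/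

/-- The Lie algebra `sl_2` over `k`. -/
abbrev Sl2 (k : Type*) [CommRing k] := LieAlgebra.SpecialLinear.sl (Fin 2) k

/-- The element `e` of `sl_2`, with matrix `(0 1; 0 0)`. -/
def Sl2.e (k : Type*) [CommRing k] : Sl2 k :=
  LieAlgebra.SpecialLinear.single 0 1 (by decide) 1

/-- The element `f` of `sl_2`, with matrix `(0 0; 1 0)`. -/
def Sl2.f (k : Type*) [CommRing k] : Sl2 k :=
  LieAlgebra.SpecialLinear.single 1 0 (by decide) 1

/-- The element `h = [e, f]` of `sl_2`, with matrix `(1 0; 0 -1)`. -/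
def Sl2.h (k : Type*) [CommRing k] : Sl2 k :=
  LieAlgebra.SpecialLinear.singleSubSingle 0 1 1

/-- The (Elias–Qi) action of `sl_2` on `nh_n` by derivations, given on generators. -/
structure IsNilHeckeAction {k : Type*} [CommRing k] {n : ℕ}
    (ρ : Sl2 k →ₗ⁅k⁆ Module.End k (NilHecke k n)) : Prop where
  leibniz : ∀ X a b, ρ X (a * b) = ρ X a * b + a * ρ X b
  e_x : ∀ i, ρ (Sl2.e k) (nhGen k n (.x i)) = nhGen k n (.x i) ^ 2
  f_x : ∀ i, ρ (Sl2.f k) (nhGen k n (.x i)) = -1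
  h_x : ∀ i, ρ (Sl2.h k) (nhGen k n (.x i)) = 2 * nhGen k n (.x i)
  e_T : ∀ (i : ℕ) (hi : i + 1 < n), ρ (Sl2.e k) (nhGen k n (.T i hi)) =
    1 - 2 * (nhGen k n (.x ⟨i, Nat.lt_of_succ_lt hi⟩) * nhGen k n (.T i hi))
  f_T : ∀ (i : ℕ) (hi : i + 1 < n), ρ (Sl2.f k) (nhGen k n (.T i hi)) = 0
  h_T : ∀ (i : ℕ) (hi : i + 1 < n), ρ (Sl2.h k) (nhGen k n (.T i hi)) =
    -2 * nhGen k n (.T i hi)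

/-- The partial derivative `∂ω_i / ∂x_r`, equal to
`∑_{j = i+1}^{r} (∏_{l = i+1}^{j-1} (x_l - x_r)) ω_j` (so to `0` if `r ≤ i`). The factors of
the product commute; they are multiplied in the order of increasing `l`. -/
noncomputable def partialOmega (k : Type*) [CommRing k] {n : ℕ} (r i : Fin n) : Enhanced k n :=
  ∑ j ∈ Finset.Ioc i r,
    (((List.finRange n).filter (fun l => i < l ∧ l < j)).map (fun l => xA k l - xA k r)).prod *
      omegaA k j

/-- The action of `sl_2` on `A_n` by derivations, given on generators. On the subalgebra generated
by the `x_i` and `ω_i`, `e`, `f`, `h` are `∑ x_r² ∂/∂x_r`, `-∑ ∂/∂x_r`, `2 ∑ x_r ∂/∂x_r`. -/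
structure IsEnhancedAction {k : Type*} [CommRing k] {n : ℕ}
    (ρ : Sl2 k →ₗ⁅k⁆ Module.End k (Enhanced k n)) : Prop where
  leibniz : ∀ X a b, ρ X (a * b) = ρ X a * b + a * ρ X b
  e_x : ∀ i, ρ (Sl2.e k) (xA k i) = xA k i ^ 2
  f_x : ∀ i, ρ (Sl2.f k) (xA k i) = -1
  h_x : ∀ i, ρ (Sl2.h k) (xA k i) = 2 * xA k i
  e_omega : ∀ i, ρ (Sl2.e k) (omegaA k i) = ∑ r, xA k r ^ 2 * partialOmega k r i
  f_omega : ∀ i, ρ (Sl2.f k) (omegaA k i) = -∑ r, partialOmega k r i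
  h_omega : ∀ i, ρ (Sl2.h k) (omegaA k i) = 2 * ∑ r, xA k r * partialOmega k r i
  e_T : ∀ (i : ℕ) (hi : i + 1 < n), ρ (Sl2.e k) (TA k i hi) =
    1 - 2 * (xA k ⟨i, Nat.lt_of_succ_lt hi⟩ * TA k i hi)
  f_T : ∀ (i : ℕ) (hi : i + 1 < n), ρ (Sl2.f k) (TA k i hi) = 0
  h_T : ∀ (i : ℕ) (hi : i + 1 < n), ρ (Sl2.h k) (TA k i hi) = -2 * TA k i hi

/-- `N` is a submodule for the action `ρ` of `sl_2`. -/
def IsSl2Stable {k M : Type*} [CommRing k] [AddCommGroup M] [Module k M]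
    (ρ : Sl2 k →ₗ⁅k⁆ Module.End k M) (N : Submodule k M) : Prop :=
  ∀ X, ∀ v ∈ N, ρ X v ∈ N

/-! ### Exterior monomials and the filtration -/

/-- The sequences `i_1 < ⋯ < i_m` in `{1, …, n}`, with the lexicographic order. -/
abbrev MonIndex (n m : ℕ) : Type := {a : Lex (Fin m → Fin n) // StrictMono (ofLex a)}

noncomputable instance (n m : ℕ) : Fintype (MonIndex n m) := by
  classical
  haveI : Finite (Lex (Fin m → Fin n)) := inferInstanceAs (Finite (Fin m → Fin n))
  exact Fintype.ofFinite _

theorem card_monIndex (n m : ℕ) : Fintype.card (MonIndex n m) = n.choose m := by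
  have e : MonIndex n m ≃ (Fin m ↪o Fin n) :=
    { toFun := fun a => OrderEmbedding.ofStrictMono (ofLex a.1) a.2
      invFun := fun g => ⟨toLex g, g.strictMono⟩
      left_inv := fun a => rfl
      right_inv := fun g => by ext; rfl }
  rw [← Nat.card_eq_fintype_card, Nat.card_congr (e.trans Set.powersetCard.ofFinEmbEquiv),
    Set.powersetCard.card, Nat.card_eq_fintype_card, Fintype.card_fin]

/-- The `s`-th sequence `i_1 < ⋯ < i_m` in lexicographic order (counted from `s = 0`). -/
noncomputable def monIndex (n m : ℕ) : Fin (n.choose m) ≃o MonIndex n m :=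
  Fintype.orderIsoFinOfCardEq (MonIndex n m) (card_monIndex n m)

/-- The `s`-th monomial `ω_{i_1} ⋯ ω_{i_m}` as an element of `A_n`. -/
noncomputable def omegaMon (k : Type*) [CommRing k] (n m : ℕ) (s : Fin (n.choose m)) :
    Enhanced k n :=
  (List.ofFn (fun t : Fin m => omegaA k (ofLex (monIndex n m s).1 t))).prod

/-- The free `k`-module of rank one spanned by the `s`-th monomial `ω_{i_1} ⋯ ω_{i_m}` in the
exterior algebra on `ω_1, …, ω_n`. -/
noncomputable def omegaLine (k : Type*) [CommRing k] (n m : ℕ) (s : Fin (n.choose m)) :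
    Submodule k (ExteriorAlgebra k (Fin n → k)) :=
  Submodule.span k
    {(List.ofFn (fun t : Fin m =>
      ExteriorAlgebra.ι k (Pi.single (ofLex (monIndex n m s).1 t) (1 : k) : Fin n → k))).prod}

/-- `A_n^{2m}(≥ j)`: the `sl_2`-submodule generated by the products of elements of `nh_n` with the
monomials `ω_r` for `r ≥ j`. The monomials are numbered from `1` here, so that the monomial
`omegaMon k n m r` has the number `r + 1`. -/
noncomputable def filtGE {k : Type*} [CommRing k] {n : ℕ}
    (ρ : Sl2 k →ₗ⁅k⁆ Module.End k (Enhanced k n)) (m j : ℕ) : Submodule k (Enhanced k n) :=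
  sInf {N | IsSl2Stable ρ N ∧ ∀ r : Fin (n.choose m), j ≤ (r : ℕ) + 1 →
    ∀ a b : NilHecke k n, nhToEnhanced k n a * omegaMon k n m r * nhToEnhanced k n b ∈ N}

end EnhancedNilHecke

open EnhancedNilHecke

/-! In suitable generators `A_n` is a tensor product on which `sl_2` sees only one factor. Number
the strands from 0 and introduce formally an operator z with z ω_i = ω_{i-1} - x_i ω_i and ω_{-1} =
0, treated as commuting with the x's. Then ω_i = ∏_{l>i} (z + x_l) ω_{n-1}, so with θ_{n-1-d} = z^d
ω_{n-1} one gets ω_i = ∑_a e_a(x_{i+1}, …, x_{n-1}) θ_{i+a}, with e_a the elementary symmetric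
polynomials.

The element z^d ω_j commutes with T_i for every i ≠ j (`TA_commute_zOmega`), because it is symmetric
in x_i and x_{i+1}. As no T has index n-1, every θ commutes with all of `nh_n`; the θ's also
anticommute and square to zero. The same computation read backwards turns the formula for ω_i into a
homomorphism on `A_n`, whence `extEquiv`: `A_n` is Λ(θ) ⊗ `nh_n`.

The Elias–Qi action, built from derivations on generators, extends to Λ(θ) ⊗ `nh_n` as the identity
tensored with it. Since the θ's are then constants, differentiating the product formula for ω_i
omits the factor z + x_r, which gives exactly the prescribed ∂_r ω_i (`partialOf_zOmega_succ`,
`IsLeibniz.map_omegaA`). Uniqueness holds because a derivation is determined on generators.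

The expansion of ω_i is unitriangular: θ_i plus terms in θ_j with j > i. Multiplying out and
sorting, each ω-monomial is the θ-monomial of the same index plus lexicographically later ones
(`omegaMon_sub_mem`), so both families span the same filtration over `nh_n` (`omegaSpan_eq`). On the
θ side stability is immediate, and the coordinate of a θ-monomial identifies the successive
quotients with copies of `nh_n`. -/

namespace EnhancedNilHecke

/-! ### Derivations of algebras given by generators and relations. -/

section Derivations

variable {k : Type*} [CommRing k] {G : Type*} {rel : FreeAlgebra k G → FreeAlgebra k G → Prop}

/-- The Leibniz rule for an endomorphism of a (noncommutative) algebra. -/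
def IsLeibniz {A : Type*} [Ring A] [Algebra k A] (D : Module.End k A) : Prop :=
  ∀ a b, D (a * b) = D a * b + a * D b

namespace IsLeibniz

variable {A : Type*} [Ring A] [Algebra k A] {D D' : Module.End k A}

theorem map_one (hD : IsLeibniz D) : D 1 = 0 := by
  simpa using hD 1 1

theorem map_algebraMap (hD : IsLeibniz D) (r : k) : D (algebraMap k A r) = 0 := by
  rw [Algebra.algebraMap_eq_smul_one, map_smul, hD.map_one, smul_zero]

theorem map_two (hD : IsLeibniz D) : D 2 = 0 := by
  rw [← one_add_one_eq_two, map_add, hD.map_one, add_zero]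

theorem add (hD : IsLeibniz D) (hD' : IsLeibniz D') : IsLeibniz (D + D') := fun a b => by
  simp only [LinearMap.add_apply, hD a b, hD' a b, add_mul, mul_add]; abel

theorem smul (hD : IsLeibniz D) (r : k) : IsLeibniz (r • D) := fun a b => by
  simp only [LinearMap.smul_apply, hD a b, smul_add, smul_mul_assoc, mul_smul_comm]

theorem lie (hD : IsLeibniz D) (hD' : IsLeibniz D') : IsLeibniz ⁅D, D'⁆ := fun a b => by
  simp only [LieRing.of_associative_ring_bracket, LinearMap.sub_apply, Module.End.mul_apply,
    hD a b, hD' a b, map_add, hD _ _, hD' _ _, sub_mul, mul_sub]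
  abel

end IsLeibniz

/-- An induction principle for quotients of free algebras. -/
theorem ringQuot_induction {P : RingQuot rel → Prop}
    (halg : ∀ r : k, P (algebraMap k _ r))
    (hgen : ∀ g, P (RingQuot.mkAlgHom k rel (FreeAlgebra.ι k g)))
    (hmul : ∀ a b, P a → P b → P (a * b)) (hadd : ∀ a b, P a → P b → P (a + b))
    (a : RingQuot rel) : P a := by
  obtain ⟨a, rfl⟩ := RingQuot.mkAlgHom_surjective k rel a
  induction a using FreeAlgebra.induction with
  | grade0 r => rw [AlgHom.commutes]; exact halg r
  | grade1 g => exact hgen g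
  | mul a b ha hb => rw [map_mul]; exact hmul _ _ ha hb
  | add a b ha hb => rw [map_add]; exact hadd _ _ ha hb

theorem IsLeibniz.ext {D D' : Module.End k (RingQuot rel)} (hD : IsLeibniz D)
    (hD' : IsLeibniz D')
    (h : ∀ g, D (RingQuot.mkAlgHom k rel (FreeAlgebra.ι k g)) =
      D' (RingQuot.mkAlgHom k rel (FreeAlgebra.ι k g))) : D = D' := by
  ext a
  induction a using ringQuot_induction (k := k) with
  | halg r => rw [hD.map_algebraMap, hD'.map_algebraMap]
  | hgen g => exact h g
  | hmul a b ha hb => rw [hD a b, hD' a b, ha, hb]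
  | hadd a b ha hb => rw [map_add, map_add, ha, hb]

/-- A derivation of a quotient of a free algebra can be prescribed on the generators, provided that
the prescription is compatible with the relations. Derivations are encoded as homomorphisms to the
dual numbers. -/
theorem exists_isLeibniz (γ d : G → RingQuot rel)
    (hγ : ∀ g, RingQuot.mkAlgHom k rel (FreeAlgebra.ι k g) = γ g)
    (h : ∀ a b, rel a b →
      (FreeAlgebra.lift k (fun g => (TrivSqZeroExt.inl (γ g) +
        TrivSqZeroExt.inr (d g) : TrivSqZeroExt (RingQuot rel) (RingQuot rel))) a).snd =
      (FreeAlgebra.lift k (fun g => (TrivSqZeroExt.inl (γ g) +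
        TrivSqZeroExt.inr (d g) : TrivSqZeroExt (RingQuot rel) (RingQuot rel))) b).snd) :
    ∃ D : Module.End k (RingQuot rel), IsLeibniz D ∧
      ∀ g, D (γ g) = d g := by
  set L := FreeAlgebra.lift k (fun g =>
    (TrivSqZeroExt.inl (γ g) +
        TrivSqZeroExt.inr (d g) : TrivSqZeroExt (RingQuot rel) (RingQuot rel))) with hL
  -- First components agree on related words automatically, which is why compatibility is only
  -- assumed for the second ones.
  have hfst : (TrivSqZeroExt.fstHom k (RingQuot rel) (RingQuot rel)).comp L =
      RingQuot.mkAlgHom k rel := by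
    ext g
    simp [hL, hγ]
  have hrel : ∀ ⦃a b⦄, rel a b → L a = L b := fun a b hab => by
    refine TrivSqZeroExt.ext ?_ (h a b hab)
    have h1 := DFunLike.congr_fun hfst a
    have h2 := DFunLike.congr_fun hfst b
    rw [RingQuot.mkAlgHom_rel k hab] at h1
    exact h1.trans h2.symm
  let Φ : RingQuot rel →ₐ[k] TrivSqZeroExt (RingQuot rel) (RingQuot rel) :=
    RingQuot.liftAlgHom k ⟨L, hrel⟩
  have hΦ : ∀ a, Φ (RingQuot.mkAlgHom k rel a) = L a := fun a =>
    RingQuot.liftAlgHom_mkAlgHom_apply ..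
  have hΦfst : ∀ a, (Φ a).fst = a := fun a => by
    obtain ⟨a, rfl⟩ := RingQuot.mkAlgHom_surjective k rel a
    rw [hΦ]
    exact DFunLike.congr_fun hfst a
  refine ⟨{ toFun := fun a => (Φ a).snd, map_add' := ?_, map_smul' := ?_ }, ?_, ?_⟩
  · intro a b; simp
  · intro r a; simp
  · intro a b
    change (Φ (a * b)).snd = (Φ a).snd * b + a * (Φ b).snd
    rw [map_mul, TrivSqZeroExt.snd_mul, hΦfst, hΦfst, add_comm, smul_eq_mul,
      op_smul_eq_mul]
  · intro g
    change (Φ _).snd = _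
    rw [← hγ, hΦ, hL, FreeAlgebra.lift_ι_apply, TrivSqZeroExt.snd_add, TrivSqZeroExt.snd_inl,
      TrivSqZeroExt.snd_inr, zero_add]

end Derivations

/-! ### Representations of `sl_2` from triples of endomorphisms. -/

section Sl2

variable {k : Type*} [CommRing k]

theorem Sl2.apply_one_one (X : Sl2 k) : X.1 1 1 = -X.1 0 0 := by
  have h : Matrix.trace X.1 = 0 := X.2
  rw [Matrix.trace_fin_two] at h
  linear_combination h

theorem Sl2.eq_sum (X : Sl2 k) :
    X = X.1 0 1 • Sl2.e k + X.1 1 0 • Sl2.f k + X.1 0 0 • Sl2.h k := by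
  ext i j
  fin_cases i <;> fin_cases j <;>
    simp [Sl2.e, Sl2.f, Sl2.h, Sl2.apply_one_one]

theorem Sl2.hom_ext {M : Type*} [AddCommGroup M] [Module k M]
    {ρ ρ' : Sl2 k →ₗ⁅k⁆ Module.End k M} (he : ρ (Sl2.e k) = ρ' (Sl2.e k))
    (hf : ρ (Sl2.f k) = ρ' (Sl2.f k)) (hh : ρ (Sl2.h k) = ρ' (Sl2.h k)) : ρ = ρ' := by
  ext1 X
  rw [Sl2.eq_sum X]
  simp only [map_add, map_smul, he, hf, hh]

/-- An `sl_2`-triple of endomorphisms is a representation of `sl_2`. -/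
theorem Sl2.exists_hom {M : Type*} [AddCommGroup M] [Module k M] {E F H : Module.End k M}
    (hEF : ⁅E, F⁆ = H) (hHE : ⁅H, E⁆ = (2 : k) • E) (hHF : ⁅H, F⁆ = -((2 : k) • F)) :
    ∃ ρ : Sl2 k →ₗ⁅k⁆ Module.End k M,
      ∀ X, ρ X = X.1 0 1 • E + X.1 1 0 • F + X.1 0 0 • H := by
  refine ⟨{ toFun := fun X => X.1 0 1 • E + X.1 1 0 • F + X.1 0 0 • H,
            map_add' := ?_, map_smul' := ?_, map_lie' := ?_ }, fun X => rfl⟩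
  · intro X Y
    have h (i j) : (X + Y).1 i j = X.1 i j + Y.1 i j := rfl
    simp only [h]
    module
  · intro r X
    have h (i j) : (r • X).1 i j = r * X.1 i j := rfl
    simp only [h, RingHom.id_apply]
    module
  · intro X Y
    have hFE : ⁅F, E⁆ = -H := by rw [← lie_skew, hEF]
    have hEH : ⁅E, H⁆ = -((2 : k) • E) := by rw [← lie_skew, hHE]
    have hFH : ⁅F, H⁆ = (2 : k) • F := by rw [← lie_skew, hHF, neg_neg]
    simp only [lie_add, add_lie, lie_smul, smul_lie, lie_self, hEF, hHE, hHF, hFE, hEH, hFH,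
      LieAlgebra.SpecialLinear.sl_bracket, Matrix.sub_apply, Matrix.mul_apply, Fin.sum_univ_two,
      Sl2.apply_one_one]
    module

end Sl2

/-! ### The nilHecke relations differentiated by e and f. -/

section NilHeckeIdentities

variable {R : Type*} [Ring R] {S U X Y : R}

/-- This and the next identities are the Leibniz rule applied to the two sides of one defining
relation, with terms ordered as multiplication of dual numbers produces them. S and U stand for
crossings, X and Y for dots. -/
theorem e_x_comm (h : X * Y = Y * X) :
    X * Y ^ 2 + X ^ 2 * Y = Y * X ^ 2 + Y ^ 2 * X := by
  linear_combination (norm := noncomm_ring) h * Y + Y * h + X * h + h * X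

theorem e_T_sq (hSX : S * X - Y * S = 1) (hS : S * S = 0) :
    S * (1 - 2 * (X * S)) + (1 - 2 * (X * S)) * S = 0 := by
  linear_combination (norm := noncomm_ring) -2 * (hSX * S) - 2 * (Y * hS) - 2 * (X * hS)

theorem e_T_comm (hSU : S * U = U * S) (hYS : Y * S = S * Y) (hXU : X * U = U * X) :
    S * (1 - 2 * (Y * U)) + (1 - 2 * (X * S)) * U =
      U * (1 - 2 * (X * S)) + (1 - 2 * (Y * U)) * S := by
  linear_combination (norm := noncomm_ring) 2 * (hYS * U) - 2 * (Y * hSU) - 2 * (hXU * S) -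
    2 * (X * hSU)

/-- Here S = T_i, U = T_{i+1}, X = x_i, Y = x_{i+1}. No relation between x_{i+1} and T_{i+1} is
needed: the formula for e(T_{i+1}) involves x_{i+1}, not x_{i+2}. -/
theorem e_braid (hXU : X * U = U * X) (hSX : S * X - Y * S = 1) (hXS : X * S - S * Y = 1)
    (hS : S * S = 0) (hU : U * U = 0) (hbr : S * U * S = U * S * U) :
    S * U * (1 - 2 * (X * S)) + (S * (1 - 2 * (Y * U)) * S + (1 - 2 * (X * S)) * U * S) =
      U * S * (1 - 2 * (Y * U)) + (U * (1 - 2 * (X * S)) * U + (1 - 2 * (Y * U)) * S * U) := by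
  linear_combination (norm := noncomm_ring) hS - 3 * hU + 2 * (S * hXU * S) -
    2 * (hSX * (U * S)) + 2 * (hXS * (U * S)) - 2 * (U * hXS * U) - 4 * (hXU * (S * U)) -
    2 * (Y * hbr) - 4 * (X * hbr)

theorem e_x_T_comm (hYS : Y * S = S * Y) (hXY : Y * X = X * Y) :
    Y * (1 - 2 * (X * S)) + Y ^ 2 * S = S * Y ^ 2 + (1 - 2 * (X * S)) * Y := by
  linear_combination (norm := noncomm_ring) -2 * (hXY * S) - 2 * (X * hYS) + Y * hYS + hYS * Y

theorem e_x_T (hXS : X * S - S * Y = 1) :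
    X * (1 - 2 * (X * S)) + X ^ 2 * S - (S * Y ^ 2 + (1 - 2 * (X * S)) * Y) = 0 := by
  linear_combination (norm := noncomm_ring) hXS * Y - X * hXS

theorem e_T_x (hSX : S * X - Y * S = 1) (hXY : X * Y = Y * X) :
    S * X ^ 2 + (1 - 2 * (X * S)) * X - (Y * (1 - 2 * (X * S)) + Y ^ 2 * S) = 0 := by
  linear_combination (norm := noncomm_ring) hSX * X + Y * hSX - 2 * (X * hSX) - 2 * (hXY * S)

theorem f_x_comm (X Y : R) : X * -1 + -Y = Y * -1 + -X := by noncomm_ring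

theorem f_x_T_comm (S : R) : -S = S * -1 := by noncomm_ring

theorem f_x_T (S : R) : -S - S * -1 = 0 := by noncomm_ring

theorem f_T_x (S : R) : S * -1 + S = 0 := by noncomm_ring

end NilHeckeIdentities

/-! ### The `sl_2` relations evaluated on the generators x and T. -/

section Commutators

variable {k R : Type*} [CommRing k] [Ring R] [Algebra k R] {E F H : Module.End k R} {x T : R}

theorem lie_e_f_x (hE : IsLeibniz E) (hF : IsLeibniz F) (hEx : E x = x ^ 2) (hFx : F x = -1) :
    ⁅E, F⁆ x = 2 * x := by
  rw [LieRing.of_associative_ring_bracket, LinearMap.sub_apply, Module.End.mul_apply,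
    Module.End.mul_apply, hFx, hEx, pow_two, hF, hFx, map_neg, hE.map_one]
  noncomm_ring

theorem lie_e_f_T (hF : IsLeibniz F) (hFx : F x = -1)
    (hET : E T = 1 - 2 * (x * T)) (hFT : F T = 0) : ⁅E, F⁆ T = -2 * T := by
  rw [LieRing.of_associative_ring_bracket, LinearMap.sub_apply, Module.End.mul_apply,
    Module.End.mul_apply, hFT, hET, map_sub, hF.map_one, hF, hF.map_two, hF, hFx, hFT, map_zero]
  noncomm_ring

theorem lie_h_e_x (hE : IsLeibniz E) (hH : IsLeibniz H) (hEx : E x = x ^ 2) (hHx : H x = 2 * x) :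
    ⁅H, E⁆ x = (2 : k) • E x := by
  rw [LieRing.of_associative_ring_bracket, LinearMap.sub_apply, Module.End.mul_apply,
    Module.End.mul_apply, hEx, hHx, hE, pow_two, hH, hHx, hE.map_two, hEx, two_smul]
  noncomm_ring

theorem lie_h_e_T (hE : IsLeibniz E) (hH : IsLeibniz H) (hHx : H x = 2 * x)
    (hET : E T = 1 - 2 * (x * T)) (hHT : H T = -2 * T) : ⁅H, E⁆ T = (2 : k) • E T := by
  rw [LieRing.of_associative_ring_bracket, LinearMap.sub_apply, Module.End.mul_apply,
    Module.End.mul_apply, hET, hHT, neg_mul, map_neg, hE, hE.map_two, map_sub, hH.map_one,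
    hH, hH.map_two, hH, hHx, hHT, hET, two_smul]
  noncomm_ring

theorem lie_h_f_x (hF : IsLeibniz F) (hH : IsLeibniz H) (hFx : F x = -1) (hHx : H x = 2 * x) :
    ⁅H, F⁆ x = -((2 : k) • F x) := by
  rw [LieRing.of_associative_ring_bracket, LinearMap.sub_apply, Module.End.mul_apply,
    Module.End.mul_apply, hFx, hHx, hF, map_neg, hH.map_one, hF.map_two, hFx, two_smul]
  noncomm_ring

theorem lie_h_f_T (hF : IsLeibniz F) (hFT : F T = 0) (hHT : H T = -2 * T) :
    ⁅H, F⁆ T = -((2 : k) • F T) := by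
  rw [LieRing.of_associative_ring_bracket, LinearMap.sub_apply, Module.End.mul_apply,
    Module.End.mul_apply, hFT, hHT, neg_mul, map_neg, hF, hF.map_two, hFT]
  simp

end Commutators

/-! ### Existence of the action on `nh_n`, and uniqueness for both algebras. -/

section NilHeckeAction

variable {k : Type*} [CommRing k] {n : ℕ}

theorem nhGen_x_comm (i j : Fin n) :
    nhGen k n (.x i) * nhGen k n (.x j) = nhGen k n (.x j) * nhGen k n (.x i) := by
  simpa only [nhGen, map_mul] using RingQuot.mkAlgHom_rel k (NHRel.x_comm (k := k) i j)

theorem nhGen_T_sq (i : ℕ) (h : i + 1 < n) : nhGen k n (.T i h) * nhGen k n (.T i h) = 0 := by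
  simpa only [nhGen, map_mul, map_zero] using RingQuot.mkAlgHom_rel k (NHRel.T_sq (k := k) i h)

theorem nhGen_T_comm (i j : ℕ) (hi : i + 1 < n) (hj : j + 1 < n)
    (hij : i + 1 < j ∨ j + 1 < i) :
    nhGen k n (.T i hi) * nhGen k n (.T j hj) = nhGen k n (.T j hj) * nhGen k n (.T i hi) := by
  simpa only [nhGen, map_mul] using RingQuot.mkAlgHom_rel k (NHRel.T_comm (k := k) i j hi hj hij)

theorem nhGen_braid (i : ℕ) (hi : i + 1 < n) (hi' : i + 1 + 1 < n) :
    nhGen k n (.T i hi) * nhGen k n (.T (i + 1) hi') * nhGen k n (.T i hi) =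
      nhGen k n (.T (i + 1) hi') * nhGen k n (.T i hi) * nhGen k n (.T (i + 1) hi') := by
  simpa only [nhGen, map_mul] using RingQuot.mkAlgHom_rel k (NHRel.braid (k := k) i hi hi')

theorem nhGen_x_T_comm (i : Fin n) (j : ℕ) (hj : j + 1 < n) (h : (i : ℕ) ≠ j)
    (h' : (i : ℕ) ≠ j + 1) :
    nhGen k n (.x i) * nhGen k n (.T j hj) = nhGen k n (.T j hj) * nhGen k n (.x i) := by
  simpa only [nhGen, map_mul] using
    RingQuot.mkAlgHom_rel k (NHRel.x_T_comm (k := k) i j hj h h')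

theorem nhGen_x_T (i : ℕ) (h : i + 1 < n) :
    nhGen k n (.x ⟨i, Nat.lt_of_succ_lt h⟩) * nhGen k n (.T i h) -
      nhGen k n (.T i h) * nhGen k n (.x ⟨i + 1, h⟩) = 1 := by
  simpa only [nhGen, map_mul, map_sub, map_one] using
    RingQuot.mkAlgHom_rel k (NHRel.x_T (k := k) i h)

theorem nhGen_T_x (i : ℕ) (h : i + 1 < n) :
    nhGen k n (.T i h) * nhGen k n (.x ⟨i, Nat.lt_of_succ_lt h⟩) -
      nhGen k n (.x ⟨i + 1, h⟩) * nhGen k n (.T i h) = 1 := by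
  simpa only [nhGen, map_mul, map_sub, map_one] using
    RingQuot.mkAlgHom_rel k (NHRel.T_x (k := k) i h)

variable (k n) in
theorem exists_nilHecke_e : ∃ D : Module.End k (NilHecke k n), IsLeibniz D ∧
    (∀ i, D (nhGen k n (.x i)) = nhGen k n (.x i) ^ 2) ∧
    ∀ (i : ℕ) (hi : i + 1 < n), D (nhGen k n (.T i hi)) =
      1 - 2 * (nhGen k n (.x ⟨i, Nat.lt_of_succ_lt hi⟩) * nhGen k n (.T i hi)) := by
  obtain ⟨D, hD, hgen⟩ := exists_isLeibniz (k := k) (rel := NHRel k n) (nhGen k n)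
    (fun g => match g with
    | .x i => nhGen k n (.x i) ^ 2
    | .T i hi => 1 - 2 * (nhGen k n (.x ⟨i, Nat.lt_of_succ_lt hi⟩) * nhGen k n (.T i hi)))
    (fun g => rfl) (by
    intro a b hab
    induction hab with
    | x_comm i j => simpa using e_x_comm (nhGen_x_comm i j)
    | T_sq i hi => simpa using e_T_sq (nhGen_T_x i hi) (nhGen_T_sq i hi)
    | T_comm i j hi hj hij =>
      simpa using e_T_comm (nhGen_T_comm i j hi hj hij)
        (nhGen_x_T_comm ⟨j, Nat.lt_of_succ_lt hj⟩ i hi (by simp only; omega) (by simp only; omega))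
        (nhGen_x_T_comm ⟨i, Nat.lt_of_succ_lt hi⟩ j hj (by simp only; omega) (by simp only; omega))
    | braid i hi hi' =>
      simpa using e_braid
        (nhGen_x_T_comm ⟨i, Nat.lt_of_succ_lt hi⟩ (i + 1) hi' (by simp) (by simp only; omega))
        (nhGen_T_x i hi) (nhGen_x_T i hi) (nhGen_T_sq i hi) (nhGen_T_sq (i + 1) hi')
        (nhGen_braid i hi hi')
    | x_T_comm i j hj h h' => simpa using e_x_T_comm (nhGen_x_T_comm i j hj h h') (nhGen_x_comm _ _)
    | x_T i hi => simpa using e_x_T (nhGen_x_T i hi)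
    | T_x i hi => simpa using e_T_x (nhGen_T_x i hi) (nhGen_x_comm _ _))
  exact ⟨D, hD, fun i => hgen (.x i), fun i hi => hgen (.T i hi)⟩

variable (k n) in
theorem exists_nilHecke_f : ∃ D : Module.End k (NilHecke k n), IsLeibniz D ∧
    (∀ i, D (nhGen k n (.x i)) = -1) ∧
    ∀ (i : ℕ) (hi : i + 1 < n), D (nhGen k n (.T i hi)) = 0 := by
  obtain ⟨D, hD, hgen⟩ := exists_isLeibniz (k := k) (rel := NHRel k n) (nhGen k n)
    (fun g => match g with
    | .x i => -1
    | .T i hi => 0)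
    (fun g => rfl) (by
    intro a b hab
    cases hab with
    | x_comm i j => simp; exact f_x_comm _ _
    | x_T_comm i j hj h h' => simp; exact f_x_T_comm _
    | x_T i hi => simp; exact f_x_T _
    | T_x i hi => simp; exact f_T_x _
    | _ => simp)
  exact ⟨D, hD, fun i => hgen (.x i), fun i hi => hgen (.T i hi)⟩

variable (k n) in
/-- The Elias-Qi action. -/
theorem exists_isNilHeckeAction :
    ∃ ρ : Sl2 k →ₗ⁅k⁆ Module.End k (NilHecke k n), IsNilHeckeAction ρ := by
  obtain ⟨E, hE, hEx, hET⟩ := exists_nilHecke_e k n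
  obtain ⟨F, hF, hFx, hFT⟩ := exists_nilHecke_f k n
  have hH : IsLeibniz ⁅E, F⁆ := hE.lie hF
  have hHx : ∀ i, ⁅E, F⁆ (nhGen k n (.x i)) = 2 * nhGen k n (.x i) := fun i =>
    lie_e_f_x hE hF (hEx i) (hFx i)
  have hHT : ∀ (i : ℕ) (hi : i + 1 < n), ⁅E, F⁆ (nhGen k n (.T i hi)) =
      -2 * nhGen k n (.T i hi) := fun i hi =>
    lie_e_f_T hF (hFx _) (hET i hi) (hFT i hi)
  -- H is taken to be the bracket of E and F, so one relation is definitional. The other two compare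
  -- derivations, hence need checking on generators only.
  obtain ⟨ρ, hρ⟩ := Sl2.exists_hom (E := E) (F := F) (H := ⁅E, F⁆) rfl
    ((hH.lie hE).ext (hE.smul 2) (by
      rintro (i | ⟨i, hi⟩)
      · exact lie_h_e_x hE hH (hEx i) (hHx i)
      · exact lie_h_e_T hE hH (hHx _) (hET i hi) (hHT i hi)))
    ((hH.lie hF).ext (by simpa using hF.smul (-2)) (by
      rintro (i | ⟨i, hi⟩)
      · exact lie_h_f_x hF hH (hFx i) (hHx i)
      · exact lie_h_f_T hF (hFT i hi) (hHT i hi)))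
  have he : ρ (Sl2.e k) = E := by rw [hρ]; simp [Sl2.e]
  have hf : ρ (Sl2.f k) = F := by rw [hρ]; simp [Sl2.f]
  have hh : ρ (Sl2.h k) = ⁅E, F⁆ := by rw [hρ]; simp [Sl2.h]
  refine ⟨ρ, fun X => ?_, ?_, ?_, ?_, ?_, ?_, ?_⟩
  · rw [hρ]
    exact ((hE.smul _).add (hF.smul _)).add (hH.smul _)
  all_goals simp only [he, hf, hh]; assumption

theorem IsNilHeckeAction.unique {ρ ρ' : Sl2 k →ₗ⁅k⁆ Module.End k (NilHecke k n)}
    (h : IsNilHeckeAction ρ) (h' : IsNilHeckeAction ρ') : ρ = ρ' := by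
  refine Sl2.hom_ext ?_ ?_ ?_ <;>
    refine IsLeibniz.ext (h.leibniz _) (h'.leibniz _) ?_ <;> rintro (i | ⟨i, hi⟩)
  · exact (h.e_x i).trans (h'.e_x i).symm
  · exact (h.e_T i hi).trans (h'.e_T i hi).symm
  · exact (h.f_x i).trans (h'.f_x i).symm
  · exact (h.f_T i hi).trans (h'.f_T i hi).symm
  · exact (h.h_x i).trans (h'.h_x i).symm
  · exact (h.h_T i hi).trans (h'.h_T i hi).symm

theorem IsEnhancedAction.unique {ρ ρ' : Sl2 k →ₗ⁅k⁆ Module.End k (Enhanced k n)}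
    (h : IsEnhancedAction ρ) (h' : IsEnhancedAction ρ') : ρ = ρ' := by
  refine Sl2.hom_ext ?_ ?_ ?_ <;>
    refine IsLeibniz.ext (h.leibniz _) (h'.leibniz _) ?_ <;> rintro ((i | ⟨i, hi⟩) | i)
  · exact (h.e_x i).trans (h'.e_x i).symm
  · exact (h.e_T i hi).trans (h'.e_T i hi).symm
  · exact (h.e_omega i).trans (h'.e_omega i).symm
  · exact (h.f_x i).trans (h'.f_x i).symm
  · exact (h.f_T i hi).trans (h'.f_T i hi).symm
  · exact (h.f_omega i).trans (h'.f_omega i).symm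
  · exact (h.h_x i).trans (h'.h_x i).symm
  · exact (h.h_T i hi).trans (h'.h_T i hi).symm
  · exact (h.h_omega i).trans (h'.h_omega i).symm

end NilHeckeAction
-- Odd elements: polynomial combinations of anticommuting generators.
section OddSpan

variable (k : Type*) {R ι κ : Type*} [CommRing k] [Ring R] [Algebra k R]

/-- The linear combinations of the `w j` with coefficients polynomials in the `x i`. -/
inductive OddSpan (x : ι → R) (w : κ → R) : R → Prop
  | gen (j : κ) : OddSpan x w (w j)
  | zero : OddSpan x w 0
  | add {a b : R} : OddSpan x w a → OddSpan x w b → OddSpan x w (a + b)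
  | mul (i : ι) {a : R} : OddSpan x w a → OddSpan x w (x i * a)
  | smul (c : k) {a : R} : OddSpan x w a → OddSpan x w (c • a)

variable {k} {x : ι → R} {w : κ → R} {a b : R}

namespace OddSpan

theorem neg (ha : OddSpan k x w a) : OddSpan k x w (-a) := by
  simpa using ha.smul (-1)

theorem sub (ha : OddSpan k x w a) (hb : OddSpan k x w b) : OddSpan k x w (a - b) := by
  simpa [sub_eq_add_neg] using ha.add hb.neg

theorem sum {α : Type*} (s : Finset α) (f : α → R) (h : ∀ i, OddSpan k x w (f i)) :
    OddSpan k x w (∑ i ∈ s, f i) :=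
  Finset.sum_induction _ _ (fun _ _ => OddSpan.add) .zero fun i _ => h i

theorem commute (hx : ∀ i j, Commute (x i) (x j)) (hxw : ∀ i j, Commute (x i) (w j))
    (ha : OddSpan k x w a) (i : ι) : Commute (x i) a := by
  induction ha with
  | gen j => exact hxw i j
  | zero => exact Commute.zero_right _
  | add _ _ iha ihb => exact iha.add_right ihb
  | mul j _ iha => exact (hx i j).mul_right iha
  | smul c _ iha => exact iha.smul_right c

theorem anticomm (hx : ∀ i j, Commute (x i) (x j)) (hxw : ∀ i j, Commute (x i) (w j))
    (hw : ∀ i j, w i * w j = -(w j * w i)) (ha : OddSpan k x w a) (hb : OddSpan k x w b) :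
    a * b = -(b * a) := by
  have aux : ∀ {c d}, OddSpan k x w c → OddSpan k x w d → (∀ j, w j * d = -(d * w j)) →
      c * d = -(d * c) := by
    intro c d hc hd h
    induction hc with
    | gen j => exact h j
    | zero => simp
    | add _ _ iha ihb => rw [add_mul, mul_add, iha, ihb, neg_add]
    | mul i _ iha =>
      rw [mul_assoc, iha, ← mul_assoc d, ← (hd.commute hx hxw i).eq, mul_neg, mul_assoc]
    | smul c _ iha => rw [smul_mul_assoc, iha, mul_smul_comm, smul_neg]
  refine aux ha hb fun j => ?_
  rw [aux hb (.gen j) fun i => hw i j, neg_neg]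

/-- Anticommutation only yields 2a² = 0, and 2 need not be regular in `k`, so squares require their
own induction. -/
theorem mul_self (hx : ∀ i j, Commute (x i) (x j)) (hxw : ∀ i j, Commute (x i) (w j))
    (hw : ∀ i j, w i * w j = -(w j * w i)) (hw2 : ∀ i, w i * w i = 0) (ha : OddSpan k x w a) :
    a * a = 0 := by
  induction ha with
  | gen j => exact hw2 j
  | zero => simp
  | add ha hb iha ihb =>
    rw [add_mul, mul_add, mul_add, iha, ihb, ha.anticomm hx hxw hw hb]
    simp
  | mul i ha iha =>
    rw [mul_assoc, ← mul_assoc _ (x i), ← (ha.commute hx hxw i).eq, mul_assoc, iha]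
    simp
  | smul c _ iha => rw [smul_mul_smul_comm, iha, smul_zero]

end OddSpan

end OddSpan

/-! ### Crossings commute with symmetric expressions in two adjacent dots. -/

section SymmetricCommute

variable {R : Type*} [Ring R] {S X Y : R}

theorem commute_T_add (hSX : S * X - Y * S = 1) (hXS : X * S - S * Y = 1) :
    Commute S (X + Y) := by
  rw [commute_iff_eq]
  linear_combination (norm := noncomm_ring) hSX - hXS

theorem commute_T_mul (hSX : S * X - Y * S = 1) (hXS : X * S - S * Y = 1) (hXY : Commute X Y) :
    Commute S (X * Y) := by
  rw [commute_iff_eq]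
  linear_combination (norm := noncomm_ring) hSX * Y - Y * hXS - hXY.eq * S

/-- Replaces `X * Y` by elementary symmetric functions in a three term recursion. -/
theorem commute_T_of_recursion {a b c : R} (hSX : S * X - Y * S = 1) (hXS : X * S - S * Y = 1)
    (hXY : Commute X Y) (ha : Commute S a) (hb : Commute S (b - Y * c)) (hc : Commute S c) :
    Commute S (a - X * b - Y * (b - Y * c)) := by
  have : a - X * b - Y * (b - Y * c) = a - (X + Y) * (b - Y * c) - X * Y * c := by noncomm_ring
  rw [this]
  exact (ha.sub_right ((commute_T_add hSX hXS).mul_right hb)).sub_right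
    ((commute_T_mul hSX hXS hXY).mul_right hc)

/-- Two steps of the inverse recursion z^d ω_{i-1} = z^{d+1} ω_i + x_i z^d ω_i bring in x_i and
x_{i+1} only through their sum and product. -/
theorem commute_T_of_recursion' {a b c : R} (hSX : S * X - Y * S = 1) (hXS : X * S - S * Y = 1)
    (hXY : Commute X Y) (ha : Commute S a) (hb : Commute S b) (hc : Commute S c) :
    Commute S (a + Y * b + X * (b + Y * c)) := by
  have : a + Y * b + X * (b + Y * c) = a + (X + Y) * b + X * Y * c := by noncomm_ring
  rw [this]
  exact (ha.add_right ((commute_T_add hSX hXS).mul_right hb)).add_right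
    ((commute_T_mul hSX hXS hXY).mul_right hc)

end SymmetricCommute

/-! ### The elements z^d ω_i of `A_n` and their commutation with `nh_n`. -/

section Constants

variable (k : Type*) [CommRing k] (n : ℕ)

/-- `x_i` as an element of `nh_n`, with the value `0` outside the range. -/
noncomputable def nhX (i : ℕ) : NilHecke k n :=
  if h : i < n then nhGen k n (.x ⟨i, h⟩) else 0

/-- `x_i` as an element of `A_n`, with the value `0` outside the range. -/
noncomputable def eX (i : ℕ) : Enhanced k n := nhToEnhanced k n (nhX k n i)

/-- `ω_i`, with the value `0` outside the range. -/
noncomputable def eOmega (i : ℕ) : Enhanced k n :=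
  if h : i < n then omegaA k ⟨i, h⟩ else 0

/-- The elements `z ^ d ω_i`, where `z` is the operator with `z ω_i = ω_{i-1} - x_i ω_i`. -/
noncomputable def zOmega : ℕ → ℕ → Enhanced k n
  | 0, i => eOmega k n i
  | d + 1, 0 => 0 - eX k n 0 * zOmega d 0
  | d + 1, i + 1 => zOmega d i - eX k n (i + 1) * zOmega d (i + 1)

variable {k n}

theorem nhX_of_lt {i : ℕ} (h : i < n) : nhX k n i = nhGen k n (.x ⟨i, h⟩) := dif_pos h

theorem xA_eq (i : Fin n) : xA k i = nhToEnhanced k n (nhGen k n (.x i)) :=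
  (nhToEnhanced_nhGen k n _).symm

theorem TA_eq (i : ℕ) (h : i + 1 < n) : TA k i h = nhToEnhanced k n (nhGen k n (.T i h)) :=
  (nhToEnhanced_nhGen k n _).symm

theorem eX_coe (i : Fin n) : eX k n i = xA k i := by
  rw [eX, nhX_of_lt i.2, xA_eq]

theorem eOmega_coe (i : Fin n) : eOmega k n i = omegaA k i := dif_pos i.2

theorem nhX_comm (i j : ℕ) : Commute (nhX k n i) (nhX k n j) := by
  rw [nhX, nhX]
  split_ifs
  · exact nhGen_x_comm _ _
  all_goals simp

theorem nhX_commute_T (i j : ℕ) (hj : j + 1 < n) (h : i ≠ j) (h' : i ≠ j + 1) :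
    Commute (nhGen k n (.T j hj)) (nhX k n i) := by
  rw [nhX]
  split_ifs
  · exact (nhGen_x_T_comm _ _ _ h h').symm
  · simp

theorem T_mul_nhX (i : ℕ) (h : i + 1 < n) :
    nhGen k n (.T i h) * nhX k n i - nhX k n (i + 1) * nhGen k n (.T i h) = 1 := by
  rw [nhX_of_lt h, nhX_of_lt (Nat.lt_of_succ_lt h)]
  exact nhGen_T_x i h

theorem nhX_mul_T (i : ℕ) (h : i + 1 < n) :
    nhX k n i * nhGen k n (.T i h) - nhGen k n (.T i h) * nhX k n (i + 1) = 1 := by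
  rw [nhX_of_lt h, nhX_of_lt (Nat.lt_of_succ_lt h)]
  exact nhGen_x_T i h

theorem omegaA_sq (i : Fin n) : omegaA k i * omegaA k i = 0 := by
  simpa only [omegaA, eGen, map_mul, map_zero] using
    RingQuot.mkAlgHom_rel k (ERel.omega_sq (k := k) i)

theorem omegaA_anticomm (i j : Fin n) : omegaA k i * omegaA k j = -(omegaA k j * omegaA k i) := by
  have := RingQuot.mkAlgHom_rel k (ERel.omega_anticomm (k := k) i j)
  rw [map_neg, map_mul, map_mul] at this
  exact this

theorem xA_commute_omegaA (i j : Fin n) : Commute (xA k i) (omegaA k j) := by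
  have := RingQuot.mkAlgHom_rel k (ERel.x_omega (k := k) i j)
  rw [map_mul, map_mul] at this
  exact this

theorem TA_commute_omegaA (i : ℕ) (hi : i + 1 < n) (j : Fin n) (hij : i ≠ j) :
    Commute (TA k i hi) (omegaA k j) := by
  have := RingQuot.mkAlgHom_rel k (ERel.T_omega (k := k) i hi j hij)
  rw [map_mul, map_mul] at this
  exact this

theorem TA_commute_omegaA_sub (i : ℕ) (h : i + 1 < n) :
    Commute (TA k i h) (omegaA k ⟨i, Nat.lt_of_succ_lt h⟩ -
      xA k ⟨i + 1, h⟩ * omegaA k ⟨i + 1, h⟩) := by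
  have := RingQuot.mkAlgHom_rel k (ERel.T_omega_self (k := k) i h)
  simp only [map_mul, map_sub] at this
  exact this

theorem xA_comm (i j : Fin n) : Commute (xA k i) (xA k j) := by
  rw [xA_eq, xA_eq]
  exact (show Commute _ _ from nhGen_x_comm i j).map (nhToEnhanced k n)

theorem oddSpan_eOmega (i : ℕ) : OddSpan k (xA k) (omegaA k (n := n)) (eOmega k n i) := by
  rw [eOmega]
  split_ifs
  · exact .gen _
  · exact .zero

theorem OddSpan.eX_mul {a : Enhanced k n} (i : ℕ) (ha : OddSpan k (xA k) (omegaA k (n := n)) a) :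
    OddSpan k (xA k) (omegaA k (n := n)) (eX k n i * a) := by
  by_cases h : i < n
  · rw [eX, nhX_of_lt h, ← xA_eq]
    exact .mul _ ha
  · rw [eX, nhX, dif_neg h, map_zero, zero_mul]
    exact .zero

theorem oddSpan_zOmega : ∀ d i, OddSpan k (xA k) (omegaA k (n := n)) (zOmega k n d i)
  | 0, i => oddSpan_eOmega i
  | d + 1, 0 => OddSpan.zero.sub ((oddSpan_zOmega d 0).eX_mul 0)
  | d + 1, i + 1 => (oddSpan_zOmega d i).sub ((oddSpan_zOmega d (i + 1)).eX_mul (i + 1))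

theorem eX_commute_TA (i j : ℕ) (hj : j + 1 < n) (h : i ≠ j) (h' : i ≠ j + 1) :
    Commute (TA k j hj) (eX k n i) := by
  rw [TA_eq]
  exact (nhX_commute_T i j hj h h').map (nhToEnhanced k n)

theorem TA_mul_eX (i : ℕ) (h : i + 1 < n) :
    TA k i h * eX k n i - eX k n (i + 1) * TA k i h = 1 := by
  simpa only [map_sub, map_mul, map_one, TA_eq, eX] using
    congrArg (nhToEnhanced k n) (T_mul_nhX (k := k) i h)

theorem eX_mul_TA (i : ℕ) (h : i + 1 < n) :
    eX k n i * TA k i h - TA k i h * eX k n (i + 1) = 1 := by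
  simpa only [map_sub, map_mul, map_one, TA_eq, eX] using
    congrArg (nhToEnhanced k n) (nhX_mul_T (k := k) i h)

theorem eX_comm (i j : ℕ) : Commute (eX k n i) (eX k n j) :=
  (nhX_comm i j).map (nhToEnhanced k n)

/-- `z ^ d ω_j` is symmetric in `x_i` and `x_{i+1}` unless `j = i`. -/
theorem TA_commute_zOmega (i : ℕ) (hi : i + 1 < n) (d j : ℕ) (hj : j < n) (hij : i ≠ j) :
    Commute (TA k i hi) (zOmega k n d j) := by
  induction d using Nat.strong_induction_on generalizing j with
  | _ d ih =>
  match d, j with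
  | 0, j =>
    rw [zOmega, eOmega, dif_pos hj]
    exact TA_commute_omegaA i hi _ hij
  | d + 1, 0 =>
    rw [zOmega]
    exact (Commute.zero_right _).sub_right
      ((eX_commute_TA 0 i hi hij.symm (by omega)).mul_right (ih d (by omega) 0 hj hij))
  | d + 1, j + 1 =>
    by_cases hji : j = i
    -- The index is now i + 1, so one step of the recursion would produce z^d ω_i, on which
    -- induction says nothing. A second step eliminates it.
    · subst hji
      match d, j with
      -- z ω_{i+1} = ω_i - x_{i+1} ω_{i+1} commutes with T_i by a defining relation.
      | 0, j =>
        rw [zOmega, zOmega, zOmega, eOmega, eOmega, dif_pos hj, dif_pos (by omega), eX,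
          nhX_of_lt hj, ← xA_eq]
        exact TA_commute_omegaA_sub j hi
      -- Here i = 0, and the second step meets ω_{-1} = 0.
      | d + 1, 0 =>
        have h1 := ih (d + 1) (by omega) 1 hj hij
        have h0 := ih d (by omega) 1 hj hij
        rw [zOmega] at h1
        rw [zOmega, zOmega, zOmega]
        exact commute_T_of_recursion (TA_mul_eX 0 hi) (eX_mul_TA 0 hi) (eX_comm _ _)
          (Commute.zero_right _) h1 h0
      | d + 1, j + 1 =>
        have h1 := ih (d + 1) (by omega) (j + 1 + 1) hj hij
        have h0 := ih d (by omega) (j + 1 + 1) hj hij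
        rw [zOmega] at h1
        rw [zOmega, zOmega, zOmega]
        exact commute_T_of_recursion (TA_mul_eX _ hi) (eX_mul_TA _ hi) (eX_comm _ _)
          (ih d (by omega) j (by omega) (by omega)) h1 h0
    · rw [zOmega]
      exact (ih d (by omega) j (by omega) (Ne.symm hji)).sub_right
        ((eX_commute_TA (j + 1) i hi hij.symm (by omega)).mul_right
          (ih d (by omega) (j + 1) hj hij))

end Constants

/-! ### The isomorphism of `A_n` with Λ(θ) ⊗ `nh_n`. -/

section Iso

variable (k : Type*) [CommRing k] (n : ℕ)

/-- The algebra `Λ(θ_1, …, θ_n) ⊗ nh_n`. -/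
abbrev ExtNilHecke : Type _ := ExteriorAlgebra k (Fin n → k) ⊗[k] NilHecke k n

/-- The generator `θ_i` of the exterior algebra. -/
noncomputable def theta (i : Fin n) : ExteriorAlgebra k (Fin n → k) :=
  ExteriorAlgebra.ι k (Pi.single i (1 : k) : Fin n → k)

/-- `θ_{n-1-d} ⊗ 1`, which corresponds to `z ^ d ω_{n-1}`. -/
noncomputable def zTheta (d : ℕ) : ExtNilHecke k n :=
  if h : d < n then theta k n ⟨n - 1 - d, by omega⟩ ⊗ₜ[k] 1 else 0

/-- The element of `Λ ⊗ nh_n` that corresponds to `z ^ d ω_{n-1-m}`. -/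
noncomputable def zTensor : ℕ → ℕ → ExtNilHecke k n
  | 0, d => zTheta k n d
  | m + 1, d => zTensor m (d + 1) + (1 ⊗ₜ[k] nhX k n (n - 1 - m)) * zTensor m d

variable {k n}

theorem theta_anticomm (i j : Fin n) : theta k n i * theta k n j = -(theta k n j * theta k n i) :=
  eq_neg_of_add_eq_zero_left (ExteriorAlgebra.ι_add_mul_swap _ _)

theorem oddSpan_zTensor : ∀ m d, OddSpan k (fun i : ℕ => (1 ⊗ₜ[k] nhX k n i : ExtNilHecke k n))
    (fun j : Fin n => theta k n j ⊗ₜ[k] 1) (zTensor k n m d)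
  | 0, d => by
    rw [zTensor, zTheta]
    split_ifs
    · exact .gen _
    · exact .zero
  | m + 1, d => (oddSpan_zTensor m (d + 1)).add ((oddSpan_zTensor m d).mul _)

theorem one_tmul_commute {a b : NilHecke k n} (h : Commute a b) :
    Commute (1 ⊗ₜ[k] a : ExtNilHecke k n) (1 ⊗ₜ[k] b) :=
  h.map (Algebra.TensorProduct.includeRight (R := k) (A := ExteriorAlgebra k (Fin n → k)))

theorem one_tmul_commute_tmul_one (a : NilHecke k n) (b : ExteriorAlgebra k (Fin n → k)) :
    Commute (1 ⊗ₜ[k] a : ExtNilHecke k n) (b ⊗ₜ[k] 1) := by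
  simp [commute_iff_eq]

theorem tmul_one_anticomm (i j : Fin n) :
    (theta k n i ⊗ₜ[k] 1 : ExtNilHecke k n) * (theta k n j ⊗ₜ[k] 1) =
      -((theta k n j ⊗ₜ[k] 1) * (theta k n i ⊗ₜ[k] 1)) := by
  simp [theta_anticomm i j, TensorProduct.neg_tmul]

theorem one_tmul_commute_zTensor (i m d : ℕ) :
    Commute (1 ⊗ₜ[k] nhX k n i) (zTensor k n m d) :=
  (oddSpan_zTensor m d).commute (fun _ _ => one_tmul_commute (nhX_comm _ _))
    (fun _ _ => one_tmul_commute_tmul_one _ _) i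

theorem zTensor_anticomm (m d m' d' : ℕ) :
    zTensor k n m d * zTensor k n m' d' = -(zTensor k n m' d' * zTensor k n m d) :=
  (oddSpan_zTensor m d).anticomm (fun _ _ => one_tmul_commute (nhX_comm _ _))
    (fun _ _ => one_tmul_commute_tmul_one _ _) tmul_one_anticomm (oddSpan_zTensor m' d')

theorem zTensor_mul_self (m d : ℕ) : zTensor k n m d * zTensor k n m d = 0 :=
  (oddSpan_zTensor m d).mul_self (fun _ _ => one_tmul_commute (nhX_comm _ _))
    (fun _ _ => one_tmul_commute_tmul_one _ _) tmul_one_anticomm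
    (fun i => by simp [theta])

theorem T_mul_one_tmul (i : ℕ) (h : i + 1 < n) :
    (1 ⊗ₜ[k] nhGen k n (.T i h) : ExtNilHecke k n) * 1 ⊗ₜ[k] nhX k n i -
      1 ⊗ₜ[k] nhX k n (i + 1) * 1 ⊗ₜ[k] nhGen k n (.T i h) = 1 := by
  simp only [Algebra.TensorProduct.tmul_mul_tmul, mul_one, ← TensorProduct.tmul_sub, T_mul_nhX,
    Algebra.TensorProduct.one_def]

theorem one_tmul_mul_T (i : ℕ) (h : i + 1 < n) :
    (1 ⊗ₜ[k] nhX k n i : ExtNilHecke k n) * 1 ⊗ₜ[k] nhGen k n (.T i h) -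
      1 ⊗ₜ[k] nhGen k n (.T i h) * 1 ⊗ₜ[k] nhX k n (i + 1) = 1 := by
  simp only [Algebra.TensorProduct.tmul_mul_tmul, mul_one, ← TensorProduct.tmul_sub, nhX_mul_T,
    Algebra.TensorProduct.one_def]

/-- The mirror of `TA_commute_zOmega`: `zTensor k n m d` models z^d ω_{n-1-m}, and the excluded case
is n-1-m = i. It supplies the T–ω relations required to define `toExt`. -/
theorem T_commute_zTensor (i : ℕ) (hi : i + 1 < n) (m d : ℕ) (hm : m < n) (him : i + m + 1 ≠ n) :
    Commute (1 ⊗ₜ[k] nhGen k n (.T i hi)) (zTensor k n m d) := by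
  induction m using Nat.strong_induction_on generalizing d with
  | _ m ih =>
  match m with
  | 0 =>
    rw [zTensor, zTheta]
    split_ifs
    · exact one_tmul_commute_tmul_one _ _
    · exact Commute.zero_right _
  | m + 1 =>
    -- In this case the element is z^d ω_{i-1}, and one step of the recursion lands on the excluded
    -- index i; a second one passes to i + 1.
    by_cases him' : i + m + 1 = n
    · match m with
      | 0 => omega
      | m + 1 =>
        have e1 : n - 1 - m = i + 1 := by omega
        have e2 : n - 1 - (m + 1) = i := by omega
        rw [zTensor, zTensor, zTensor, e1, e2]
        exact commute_T_of_recursion' (T_mul_one_tmul i hi) (one_tmul_mul_T i hi)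
          (one_tmul_commute (nhX_comm _ _)) (ih m (by omega) _ (by omega) (by omega))
          (ih m (by omega) _ (by omega) (by omega)) (ih m (by omega) _ (by omega) (by omega))
    · rw [zTensor]
      exact (ih m (by omega) _ (by omega) him').add_right
        ((one_tmul_commute (nhX_commute_T _ _ _ (by omega) (by omega))).mul_right
          (ih m (by omega) _ (by omega) him'))

variable (k n) in
/-- The values on generators of the homomorphism `A_n → Λ ⊗ nh_n`. -/
noncomputable def toExtGen : EGen n → ExtNilHecke k n
  | .inl g => 1 ⊗ₜ[k] nhGen k n g
  | .inr i => zTensor k n (n - 1 - i) 0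

theorem lift_toExtGen_nh (a : FreeAlgebra k (NHGen n)) :
    FreeAlgebra.lift k (toExtGen k n)
      (FreeAlgebra.lift k (fun g => FreeAlgebra.ι k (Sum.inl g : EGen n)) a) =
      1 ⊗ₜ[k] RingQuot.mkAlgHom k (NHRel k n) a := by
  have : (FreeAlgebra.lift k (toExtGen k n)).comp
      (FreeAlgebra.lift k (fun g => FreeAlgebra.ι k (Sum.inl g : EGen n))) =
      (Algebra.TensorProduct.includeRight (R := k) (A := ExteriorAlgebra k (Fin n → k))).comp
        (RingQuot.mkAlgHom k (NHRel k n)) := by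
    ext g
    simp [toExtGen, nhGen]
  exact DFunLike.congr_fun this a

variable (k n) in
/-- The homomorphism `A_n → Λ ⊗ nh_n`. -/
noncomputable def toExt : Enhanced k n →ₐ[k] ExtNilHecke k n :=
  RingQuot.liftAlgHom k ⟨FreeAlgebra.lift k (toExtGen k n), by
    intro a b hab
    induction hab with
    | nh h => rw [lift_toExtGen_nh, lift_toExtGen_nh, RingQuot.mkAlgHom_rel k h]
    | omega_sq i =>
      simpa only [map_mul, map_zero, FreeAlgebra.lift_ι_apply, toExtGen] using zTensor_mul_self _ _
    | omega_anticomm i j =>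
      simpa only [map_mul, map_neg, FreeAlgebra.lift_ι_apply, toExtGen] using zTensor_anticomm _ _ _ _
    | x_omega i j =>
      simp only [map_mul, FreeAlgebra.lift_ι_apply, toExtGen]
      rw [← nhX_of_lt i.2]
      exact one_tmul_commute_zTensor _ _ _
    | T_omega i hi j hij =>
      simp only [map_mul, FreeAlgebra.lift_ι_apply, toExtGen]
      exact T_commute_zTensor i hi _ _ (by omega) (by omega)
    | T_omega_self i h =>
      simp only [map_mul, map_sub, FreeAlgebra.lift_ι_apply, toExtGen]
      rw [← nhX_of_lt h]
      -- ω_i - x_{i+1} ω_{i+1} corresponds to z ω_{i+1}, that is, to exponent 1 at an index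
      -- different from i.
      have e1 : n - 1 - i = n - 1 - (i + 1) + 1 := by omega
      have e2 : n - 1 - (n - 1 - (i + 1)) = i + 1 := by omega
      rw [e1, zTensor, e2, add_sub_cancel_right]
      exact T_commute_zTensor i h _ _ (by omega) (by omega)⟩

theorem toExt_eGen (g : EGen n) : toExt k n (eGen k n g) = toExtGen k n g := by
  rw [toExt, eGen, RingQuot.liftAlgHom_mkAlgHom_apply, FreeAlgebra.lift_ι_apply]

theorem toExt_nhToEnhanced (a : NilHecke k n) : toExt k n (nhToEnhanced k n a) = 1 ⊗ₜ[k] a := by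
  obtain ⟨a, rfl⟩ := RingQuot.mkAlgHom_surjective k _ a
  rw [← lift_toExtGen_nh, nhToEnhanced, RingQuot.liftAlgHom_mkAlgHom_apply, AlgHom.comp_apply,
    toExt, RingQuot.liftAlgHom_mkAlgHom_apply]

theorem toExt_omegaA (i : Fin n) : toExt k n (omegaA k i) = zTensor k n (n - 1 - i) 0 :=
  toExt_eGen _

/-- The bound is essential: from exponent n on, `zTheta` is set to 0, whereas `zOmega` goes on with
combinations that need not vanish. -/
theorem toExt_zOmega (d m : ℕ) (h : m + d < n) :
    toExt k n (zOmega k n d (n - 1 - m)) = zTensor k n m d := by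
  induction d generalizing m with
  | zero =>
    rw [zOmega, eOmega, dif_pos (by omega), toExt_omegaA]
    congr 1
    simp only
    omega
  | succ d ih =>
    obtain ⟨i, hi⟩ : ∃ i, n - 1 - m = i + 1 := ⟨n - 1 - m - 1, by omega⟩
    have hi' : i = n - 1 - (m + 1) := by omega
    rw [hi, zOmega, map_sub, map_mul, eX, toExt_nhToEnhanced, ← hi, hi', ih _ (by omega),
      ih _ (by omega), zTensor, add_sub_cancel_right]

variable (k n) in
/-- The element of `A_n` that corresponds to `θ_i`. -/
noncomputable def thetaA (i : Fin n) : Enhanced k n := zOmega k n (n - 1 - i) (n - 1)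

theorem toExt_thetaA (i : Fin n) : toExt k n (thetaA k n i) = theta k n i ⊗ₜ[k] 1 := by
  have := toExt_zOmega (k := k) (n := n) (n - 1 - i) 0 (by omega)
  rw [Nat.sub_zero] at this
  rw [thetaA, this, zTensor, zTheta, dif_pos (by omega)]
  congr 3
  omega

theorem oddSpan_linearCombination (v : Fin n → k) :
    OddSpan k (xA k) (omegaA k (n := n)) (Fintype.linearCombination k (thetaA k n) v) := by
  rw [Fintype.linearCombination_apply]
  exact OddSpan.sum _ _ fun i => (oddSpan_zOmega _ _).smul _

variable (k n) in
/-- The homomorphism `Λ → A_n` with `θ_i ↦ thetaA i`. -/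
noncomputable def extToEnhanced : ExteriorAlgebra k (Fin n → k) →ₐ[k] Enhanced k n :=
  ExteriorAlgebra.lift k ⟨Fintype.linearCombination k (thetaA k n), fun v =>
    (oddSpan_linearCombination v).mul_self xA_comm xA_commute_omegaA omegaA_anticomm omegaA_sq⟩

theorem extToEnhanced_theta (i : Fin n) : extToEnhanced k n (theta k n i) = thetaA k n i := by
  rw [extToEnhanced, theta, ExteriorAlgebra.lift_ι_apply, Fintype.linearCombination_apply_single,
    one_smul]

/-- θ_i is a z-power of ω_{n-1}, and a crossing T_j has j + 1 < n, so the exceptional index j = n-1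
never occurs. -/
theorem thetaA_commute_nhToEnhanced (i : Fin n) (b : NilHecke k n) :
    Commute (thetaA k n i) (nhToEnhanced k n b) := by
  induction b using ringQuot_induction (k := k) with
  | halg r => rw [AlgHom.commutes]; exact (Algebra.commutes r _).symm
  | hgen g =>
    rcases g with (j | ⟨j, hj⟩)
    · change Commute _ (nhToEnhanced k n (nhGen k n _))
      rw [← xA_eq]
      exact ((oddSpan_zOmega _ _).commute xA_comm xA_commute_omegaA j).symm
    · change Commute _ (nhToEnhanced k n (nhGen k n _))
      rw [← TA_eq]
      exact (TA_commute_zOmega _ _ _ _ (by omega) (by omega)).symm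
  | hmul a b ha hb => rw [map_mul]; exact ha.mul_right hb
  | hadd a b ha hb => rw [map_add]; exact ha.add_right hb

theorem extToEnhanced_commute (a : ExteriorAlgebra k (Fin n → k)) (b : NilHecke k n) :
    Commute (extToEnhanced k n a) (nhToEnhanced k n b) := by
  induction a using ExteriorAlgebra.induction with
  | algebraMap r => rw [AlgHom.commutes]; exact Algebra.commutes r _
  | ι v =>
    rw [extToEnhanced, ExteriorAlgebra.lift_ι_apply, Fintype.linearCombination_apply]
    exact Commute.sum_left _ _ _ fun i _ => (thetaA_commute_nhToEnhanced i b).smul_left _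
  | mul a c ha hc => rw [map_mul]; exact ha.mul_left hc
  | add a c ha hc => rw [map_add]; exact ha.add_left hc

variable (k n) in
/-- The homomorphism `Λ ⊗ nh_n → A_n`. -/
noncomputable def ofExt : ExtNilHecke k n →ₐ[k] Enhanced k n :=
  Algebra.TensorProduct.lift (extToEnhanced k n) (nhToEnhanced k n) extToEnhanced_commute

theorem ofExt_tmul (a : ExteriorAlgebra k (Fin n → k)) (b : NilHecke k n) :
    ofExt k n (a ⊗ₜ[k] b) = extToEnhanced k n a * nhToEnhanced k n b :=
  Algebra.TensorProduct.lift_tmul ..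

theorem ofExt_zTensor (m d : ℕ) (h : m + d < n) :
    ofExt k n (zTensor k n m d) = zOmega k n d (n - 1 - m) := by
  induction m generalizing d with
  | zero =>
    rw [zTensor, zTheta, dif_pos (by omega), ofExt_tmul, map_one, mul_one, extToEnhanced_theta,
      thetaA]
    congr 1
    simp only
    omega
  | succ m ih =>
    obtain ⟨i, hi⟩ : ∃ i, n - 1 - m = i + 1 := ⟨n - 1 - m - 1, by omega⟩
    have hi' : n - 1 - (m + 1) = i := by omega
    rw [zTensor, map_add, map_mul, ih _ (by omega), ih _ (by omega), hi', hi, zOmega, ofExt_tmul,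
      map_one, one_mul, eX, sub_add_cancel]

variable (k n) in
/-- The isomorphism `A_n ≃ Λ ⊗ nh_n`. -/
noncomputable def extEquiv : Enhanced k n ≃ₐ[k] ExtNilHecke k n :=
  AlgEquiv.ofAlgHom (toExt k n) (ofExt k n)
    (by
      refine Algebra.TensorProduct.ext (ExteriorAlgebra.hom_ext (LinearMap.pi_ext' fun i =>
        LinearMap.ext_ring ?_)) (AlgHom.ext fun b => ?_)
      · change toExt k n (ofExt k n (theta k n i ⊗ₜ[k] 1)) = theta k n i ⊗ₜ[k] 1
        rw [ofExt_tmul, map_one, mul_one, extToEnhanced_theta, toExt_thetaA]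
      · change toExt k n (ofExt k n (1 ⊗ₜ[k] b)) = 1 ⊗ₜ[k] b
        rw [ofExt_tmul, map_one, one_mul, toExt_nhToEnhanced])
    (by
      refine AlgHom.ext fun a => ?_
      change ofExt k n (toExt k n a) = a
      induction a using ringQuot_induction (k := k) with
      | halg r => rw [AlgHom.commutes, AlgHom.commutes]
      | hgen g =>
        change ofExt k n (toExt k n (eGen k n g)) = eGen k n g
        rw [toExt_eGen]
        rcases g with g | i
        · rw [toExtGen, ofExt_tmul, map_one, one_mul, nhToEnhanced_nhGen]
        · rw [toExtGen, ofExt_zTensor _ _ (by omega), zOmega]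
          have : n - 1 - (n - 1 - (i : ℕ)) = i := by omega
          rw [this, eOmega_coe]
          rfl
      | hmul a b ha hb => rw [map_mul, map_mul, ha, hb]
      | hadd a b ha hb => rw [map_add, map_add, ha, hb])

theorem extEquiv_apply (a : Enhanced k n) : extEquiv k n a = toExt k n a := rfl

theorem extEquiv_symm_apply (a : ExtNilHecke k n) : (extEquiv k n).symm a = ofExt k n a := rfl

end Iso

/-! ### The partial derivatives of ω_i and the chain rule. -/

section PartialDerivatives

theorem finRange_filter_cons {n : ℕ} (i i' j : Fin n) (hi : (i' : ℕ) = i + 1) (hj : i' < j) :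
    (List.finRange n).filter (fun l => i < l ∧ l < j) =
      i' :: (List.finRange n).filter (fun l => i' < l ∧ l < j) := by
  have hsort := List.pairwise_lt_finRange n
  refine List.Perm.eq_of_pairwise (le := (· < ·)) (fun a b _ _ h h' => (lt_asymm h h').elim)
    (hsort.filter _) ?_ ?_
  · rw [List.pairwise_cons]
    refine ⟨fun a ha => ?_, hsort.filter _⟩
    simp only [List.mem_filter, decide_eq_true_eq] at ha
    exact ha.2.1
  · rw [List.perm_ext_iff_of_nodup ((List.nodup_finRange n).filter _)]
    · intro a
      simp only [List.mem_filter, List.mem_finRange, true_and, List.mem_cons, decide_eq_true_eq,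
        Fin.lt_def, Fin.ext_iff] at hj ⊢
      omega
    · rw [List.nodup_cons]
      exact ⟨by simp, (List.nodup_finRange n).filter _⟩

theorem finRange_filter_nil {n : ℕ} (i i' : Fin n) (hi : (i' : ℕ) = i + 1) :
    (List.finRange n).filter (fun l => i < l ∧ l < i') = [] := by
  rw [List.filter_eq_nil_iff]
  intro a _
  simp only [decide_eq_true_eq, Fin.lt_def]
  omega

variable {k : Type*} [CommRing k] {n : ℕ}

/-- `∂ω_i / ∂x_r`, with arbitrary elements in place of `ω_1, …, ω_n`. -/
noncomputable def partialOf (w : Fin n → Enhanced k n) (r i : Fin n) : Enhanced k n :=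
  ∑ j ∈ Finset.Ioc i r,
    (((List.finRange n).filter (fun l => i < l ∧ l < j)).map (fun l => xA k l - xA k r)).prod * w j

theorem partialOf_of_le (w : Fin n → Enhanced k n) {r i : Fin n} (h : r ≤ i) :
    partialOf w r i = 0 := by
  rw [partialOf, Finset.Ioc_eq_empty (not_lt.2 h), Finset.sum_empty]

/-- Horner's scheme: the term j = i+1 has an empty product, and all later terms share the factor
x_{i+1} - x_r. -/
theorem partialOf_of_lt (w : Fin n → Enhanced k n) {r i i' : Fin n} (hi : (i' : ℕ) = i + 1)
    (h : i < r) :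
    partialOf w r i = w i' + (xA k i' - xA k r) * partialOf w r i' := by
  have : Finset.Ioc i r = insert i' (Finset.Ioc i' r) := by
    ext a
    simp only [Finset.mem_Ioc, Finset.mem_insert, Fin.lt_def, Fin.le_def, Fin.ext_iff] at h ⊢
    omega
  rw [partialOf, this, Finset.sum_insert (by simp), finRange_filter_nil i i' hi, List.map_nil,
    List.prod_nil, one_mul, partialOf, Finset.mul_sum]
  congr 1
  refine Finset.sum_congr rfl fun j hj => ?_
  rw [finRange_filter_cons i i' j hi (Finset.mem_Ioc.1 hj).1, List.map_cons, List.prod_cons,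
    mul_assoc]

theorem zOmega_succ (d : ℕ) {i i' : Fin n} (hi : (i' : ℕ) = i + 1) :
    zOmega k n (d + 1) i' = zOmega k n d i - xA k i' * zOmega k n d i' := by
  rw [← eX_coe, hi, zOmega]

theorem partialOf_recursion {R : Type*} [Ring R] {x y w w' p p' : R} (h : p' + y * p = w')
    (hxy : Commute x y) : w - x * w' + (x - y) * p' + y * (w' + (x - y) * p) = w := by
  rw [← h]
  linear_combination (norm := noncomm_ring) -hxy.eq * p

theorem mul_partialOf_recursion {R : Type*} [Ring R] {x y w' p p' c : R} (h : p' + y * p = w')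
    (hc : Commute c x) : c * (w' + (x - y) * p) = c * p' + x * (c * p) + 0 := by
  rw [← h]
  linear_combination (norm := noncomm_ring) hc.eq * p

/-- `(z + x_r) ∂ω_i / ∂x_r = ω_i`. -/
theorem partialOf_zOmega_succ (d : ℕ) (r i : Fin n) (h : i < r) :
    partialOf (fun j => zOmega k n (d + 1) j) r i +
      xA k r * partialOf (fun j => zOmega k n d j) r i = zOmega k n d i := by
  obtain ⟨m, hm⟩ : ∃ m : ℕ, (r : ℕ) = i + 1 + m := ⟨r - i - 1, by have := Fin.lt_def.1 h; omega⟩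
  induction m generalizing i with
  | zero =>
    have hr : (r : ℕ) = i + 1 := hm
    rw [partialOf_of_lt _ hr h, partialOf_of_lt _ hr h, partialOf_of_le _ le_rfl,
      partialOf_of_le _ le_rfl, mul_zero, add_zero, add_zero, zOmega_succ d hr,
      sub_add_cancel]
  | succ m ih =>
    have hi : ((⟨i + 1, by omega⟩ : Fin n) : ℕ) = i + 1 := rfl
    rw [partialOf_of_lt _ hi h, partialOf_of_lt _ hi h, zOmega_succ d hi]
    exact partialOf_recursion
      (ih ⟨i + 1, by omega⟩ (Fin.lt_def.2 (by simp only; omega)) (by simp only; omega))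
      (xA_comm _ _)

variable {D : Module.End k (Enhanced k n)}

/-- A derivation that annihilates the constants `θ_i` satisfies the chain rule on `z ^ d ω_i`. -/
theorem IsLeibniz.map_zOmega (hD : IsLeibniz D) (hx : ∀ r i, Commute (D (xA k r)) (xA k i))
    (hθ : ∀ i, D (thetaA k n i) = 0) (m d : ℕ) (h : m + d < n) (i : Fin n)
    (hi : (i : ℕ) + m + 1 = n) :
    D (zOmega k n d i) = ∑ r, D (xA k r) * partialOf (fun j => zOmega k n d j) r i := by
  induction m generalizing d i with
  | zero =>
    -- At the top index, z^d ω_{n-1} is the constant θ_{n-1-d}, and there are no partial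
    -- derivatives.
    have := hθ ⟨n - 1 - d, by omega⟩
    rw [thetaA] at this
    have e1 : n - 1 - (n - 1 - d) = d := by omega
    have e2 : n - 1 = i := by omega
    rw [e1, e2] at this
    rw [this, Finset.sum_eq_zero]
    intro r _
    rw [partialOf_of_le _ (Fin.le_def.2 (by omega)), mul_zero]
  | succ m ih =>
    have hi' : ((⟨i + 1, by omega⟩ : Fin n) : ℕ) = i + 1 := rfl
    set i' : Fin n := ⟨i + 1, by omega⟩
    -- This is the r-th term of D applied to z^d ω_i = z^{d+1} ω_{i'} + x_{i'} z^d ω_{i'}, with i' =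
    -- i + 1. The factor x_{i'} itself is differentiated only for r = i'; for r > i' the identity (z
    -- + x_r) ∂_r ω_{i'} = ω_{i'} applies.
    have key : ∀ r, D (xA k r) * partialOf (fun j => zOmega k n d j) r i =
        D (xA k r) * partialOf (fun j => zOmega k n (d + 1) j) r i' +
          xA k i' * (D (xA k r) * partialOf (fun j => zOmega k n d j) r i') +
          (if r = i' then D (xA k r) * zOmega k n d i' else 0) := by
      intro r
      rcases lt_trichotomy r i' with hr | rfl | hr
      · rw [if_neg hr.ne, partialOf_of_le _ hr.le, partialOf_of_le _ hr.le,
          partialOf_of_le _ (Fin.le_def.2 (by rw [Fin.lt_def] at hr; omega))]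
        simp
      · rw [if_pos rfl, partialOf_of_le _ le_rfl, partialOf_of_le _ le_rfl,
          partialOf_of_lt _ hi' (Fin.lt_def.2 (by omega)), partialOf_of_le _ le_rfl]
        simp
      · rw [if_neg hr.ne', partialOf_of_lt _ hi' (lt_trans (Fin.lt_def.2 (by omega)) hr)]
        exact mul_partialOf_recursion (partialOf_zOmega_succ d r i' hr) (hx r i')
    rw [Finset.sum_congr rfl fun r _ => key r, Finset.sum_add_distrib, Finset.sum_add_distrib,
      Finset.sum_ite_eq' Finset.univ i', if_pos (Finset.mem_univ _), ← Finset.mul_sum,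
      ← ih (d + 1) (by omega) i' (by omega), ← ih d (by omega) i' (by omega),
      zOmega_succ d hi', map_sub, hD]
    abel

theorem IsLeibniz.map_omegaA (hD : IsLeibniz D) (hx : ∀ r i, Commute (D (xA k r)) (xA k i))
    (hθ : ∀ i, D (thetaA k n i) = 0) (i : Fin n) :
    D (omegaA k i) = ∑ r, D (xA k r) * partialOmega k r i := by
  have h := hD.map_zOmega hx hθ (n - 1 - i) 0 (by omega) i (by omega)
  have h0 : (fun j : Fin n => zOmega k n 0 j) = omegaA k := funext fun j => eOmega_coe j
  rw [h0] at h
  rw [← eOmega_coe]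
  exact h

end PartialDerivatives

/-! ### The action on `A_n` that annihilates the θ's. -/

section EnhancedAction

variable {k : Type*} [CommRing k] {n : ℕ}

theorem IsLeibniz.lTensor {A B : Type*} [Ring A] [Ring B] [Algebra k A] [Algebra k B]
    {D : Module.End k B} (hD : IsLeibniz D) : IsLeibniz (LinearMap.lTensor A D) := by
  intro a b
  induction a with
  | zero => simp
  | add a a' ha ha' => rw [add_mul, map_add, map_add, ha, ha', add_mul, add_mul]; abel
  | tmul a a' =>
    induction b with
    | zero => simp
    | add b b' hb hb' => rw [mul_add, map_add, map_add, hb, hb', mul_add, mul_add]; abel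
    | tmul b b' =>
      simp only [Algebra.TensorProduct.tmul_mul_tmul, LinearMap.lTensor_tmul, hD a' b',
        TensorProduct.tmul_add]

/-- The derivation of `A_n` that extends a derivation of `nh_n` and annihilates the constants. -/
noncomputable def extendEnd (D : Module.End k (NilHecke k n)) : Module.End k (Enhanced k n) :=
  (extEquiv k n).symm.toLinearMap ∘ₗ
    LinearMap.lTensor (ExteriorAlgebra k (Fin n → k)) D ∘ₗ (extEquiv k n).toLinearMap

theorem extendEnd_apply (D : Module.End k (NilHecke k n)) (a : Enhanced k n) :
    extendEnd D a = (extEquiv k n).symm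
      (LinearMap.lTensor (ExteriorAlgebra k (Fin n → k)) D (extEquiv k n a)) := rfl

theorem extEquiv_extendEnd (D : Module.End k (NilHecke k n)) (a : Enhanced k n) :
    extEquiv k n (extendEnd D a) =
      LinearMap.lTensor (ExteriorAlgebra k (Fin n → k)) D (extEquiv k n a) := by
  rw [extendEnd_apply, AlgEquiv.apply_symm_apply]

theorem extendEnd_mul (D D' : Module.End k (NilHecke k n)) :
    extendEnd (D * D') = extendEnd D * extendEnd D' := by
  ext a
  apply (extEquiv k n).injective
  rw [Module.End.mul_apply, extEquiv_extendEnd, extEquiv_extendEnd, extEquiv_extendEnd,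
    LinearMap.lTensor_mul, Module.End.mul_apply]

theorem extendEnd_isLeibniz {D : Module.End k (NilHecke k n)} (hD : IsLeibniz D) :
    IsLeibniz (extendEnd D) := by
  intro a b
  apply (extEquiv k n).injective
  simp only [map_add, map_mul, extEquiv_extendEnd]
  exact hD.lTensor _ _

theorem extendEnd_nhToEnhanced (D : Module.End k (NilHecke k n)) (b : NilHecke k n) :
    extendEnd D (nhToEnhanced k n b) = nhToEnhanced k n (D b) := by
  rw [extendEnd_apply, extEquiv_apply, toExt_nhToEnhanced, LinearMap.lTensor_tmul,
    extEquiv_symm_apply, ofExt_tmul, map_one, one_mul]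

theorem extendEnd_extToEnhanced_mul (D : Module.End k (NilHecke k n))
    (a : ExteriorAlgebra k (Fin n → k)) (b : NilHecke k n) :
    extendEnd D (extToEnhanced k n a * nhToEnhanced k n b) =
      extToEnhanced k n a * nhToEnhanced k n (D b) := by
  rw [← ofExt_tmul, ← extEquiv_symm_apply, extendEnd_apply, AlgEquiv.apply_symm_apply,
    LinearMap.lTensor_tmul, extEquiv_symm_apply, ofExt_tmul]

theorem extendEnd_thetaA {D : Module.End k (NilHecke k n)} (hD : IsLeibniz D) (i : Fin n) :
    extendEnd D (thetaA k n i) = 0 := by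
  have := extendEnd_extToEnhanced_mul D (theta k n i) 1
  rwa [map_one, mul_one, hD.map_one, map_zero, mul_zero, extToEnhanced_theta] at this

/-- The action of `sl_2` on `A_n` that extends an action on `nh_n` and annihilates the
constants. -/
noncomputable def extendAction (ρ₀ : Sl2 k →ₗ⁅k⁆ Module.End k (NilHecke k n)) :
    Sl2 k →ₗ⁅k⁆ Module.End k (Enhanced k n) where
  toFun X := extendEnd (ρ₀ X)
  map_add' X Y := by
    ext a
    simp [extendEnd_apply, LinearMap.lTensor_add]
  map_smul' r X := by
    ext a
    simp [extendEnd_apply, LinearMap.lTensor_smul]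
  map_lie' {X Y} := by
    rw [LieHom.map_lie, LieRing.of_associative_ring_bracket, LieRing.of_associative_ring_bracket,
      ← extendEnd_mul, ← extendEnd_mul]
    ext a
    simp [extendEnd_apply, LinearMap.lTensor_sub]

theorem extendAction_apply (ρ₀ : Sl2 k →ₗ⁅k⁆ Module.End k (NilHecke k n)) (X : Sl2 k) :
    extendAction ρ₀ X = extendEnd (ρ₀ X) := rfl

/-- The values on the ω_i are not imposed: the chain rule forces them once the θ's are annihilated.
It applies because e, f and h send each x_r to an element commuting with every x_i. -/
theorem isEnhancedAction_extendAction {ρ₀ : Sl2 k →ₗ⁅k⁆ Module.End k (NilHecke k n)}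
    (h : IsNilHeckeAction ρ₀) : IsEnhancedAction (extendAction ρ₀) := by
  have hL : ∀ X, IsLeibniz (ρ₀ X) := h.leibniz
  have hL' : ∀ X, IsLeibniz (extendAction ρ₀ X) := fun X => extendEnd_isLeibniz (hL X)
  have hnh : ∀ X b, extendAction ρ₀ X (nhToEnhanced k n b) = nhToEnhanced k n (ρ₀ X b) :=
    fun X b => extendEnd_nhToEnhanced _ _
  have he : ∀ i, extendAction ρ₀ (Sl2.e k) (xA k i) = xA k i ^ 2 := fun i => by
    rw [xA_eq, hnh, h.e_x, map_pow]
  have hf : ∀ i, extendAction ρ₀ (Sl2.f k) (xA k i) = -1 := fun i => by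
    rw [xA_eq, hnh, h.f_x]
    exact (map_neg (nhToEnhanced k n) 1).trans (congrArg _ (map_one _))
  have hh : ∀ i, extendAction ρ₀ (Sl2.h k) (xA k i) = 2 * xA k i := fun i => by
    rw [xA_eq, hnh, h.h_x, map_mul, map_ofNat]
  have hω := fun X => (hL' X).map_omegaA (n := n)
  refine ⟨fun X => hL' X, he, hf, hh, fun i => ?_, fun i => ?_, fun i => ?_, fun i hi => ?_,
    fun i hi => ?_, fun i hi => ?_⟩
  · rw [hω _ (fun r i => ?_) (extendEnd_thetaA (hL _))]
    · simp only [he]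
    · rw [he]
      exact (xA_comm r i).pow_left 2
  · rw [hω _ (fun r i => ?_) (extendEnd_thetaA (hL _))]
    · simp only [hf]
      rw [← Finset.mul_sum]
      exact neg_one_mul (∑ r, partialOmega k r i)
    · rw [hf]
      exact Commute.neg_one_left (xA k i)
  · rw [hω _ (fun r i => ?_) (extendEnd_thetaA (hL _))]
    · simp only [hh, Finset.mul_sum, mul_assoc]
    · rw [hh]
      exact (Nat.cast_commute 2 (xA k i)).mul_left (xA_comm r i)
  · rw [TA_eq, hnh, h.e_T, map_sub, map_mul, map_mul, map_one, map_ofNat, xA_eq]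
  · rw [TA_eq, hnh, h.f_T, map_zero]
  · rw [TA_eq, hnh, h.h_T, map_mul]
    congr 1
    exact (map_neg (nhToEnhanced k n) 2).trans (congrArg _ (map_ofNat _ 2))

end EnhancedAction

/-! ### Monomials in the θ's: sorting, lexicographic order, coordinates. -/

section Monomials

variable (k : Type*) [CommRing k] {n m : ℕ}

/-- The product `θ_{j_1} ⋯ θ_{j_m}`. -/
noncomputable def thetaProd (j : Fin m → Fin n) : ExteriorAlgebra k (Fin n → k) :=
  ExteriorAlgebra.ιMulti k m fun t => Pi.single (j t) 1

variable {k}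

theorem thetaProd_eq (j : Fin m → Fin n) :
    thetaProd k j = (List.ofFn fun t => theta k n (j t)).prod :=
  ExteriorAlgebra.ιMulti_apply _

theorem thetaProd_cons (i : Fin n) (j : Fin m → Fin n) :
    thetaProd k (Fin.cons i j : Fin (m + 1) → Fin n) = theta k n i * thetaProd k j := by
  simp [thetaProd_eq]

theorem thetaProd_zero (j : Fin 0 → Fin n) : thetaProd k j = 1 := by
  simp [thetaProd_eq]

theorem thetaProd_eq_zero {j : Fin m → Fin n} (hj : ¬ Function.Injective j) :
    thetaProd k j = 0 :=
  ExteriorAlgebra.ιMulti_eq_zero_of_not_inj fun h => hj fun _ _ hab =>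
    h (congrArg (fun i => (Pi.single i 1 : Fin n → k)) hab)

theorem thetaProd_perm (j : Fin m → Fin n) (σ : Equiv.Perm (Fin m)) :
    thetaProd k (j ∘ σ) = ((Equiv.Perm.sign σ : ℤ) : k) • thetaProd k j := by
  rw [Int.cast_smul_eq_zsmul]
  exact (ExteriorAlgebra.ιMulti k m).map_perm (fun t => (Pi.single (j t) 1 : Fin n → k)) σ

theorem thetaProd_sort (j : Fin m → Fin n) :
    thetaProd k j = ((Equiv.Perm.sign (Tuple.sort j) : ℤ) : k) •
      thetaProd k (j ∘ Tuple.sort j) := by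
  rw [thetaProd_perm, smul_smul, ← Int.cast_mul, ← Units.val_mul, Int.units_mul_self]
  simp

/-- A family bounded below by an increasing sequence stays so after sorting. -/
theorem le_comp_of_strictMono {a j : Fin m → Fin n} (ha : StrictMono a) (haj : a ≤ j)
    {σ : Equiv.Perm (Fin m)} (hσ : Monotone (j ∘ σ)) : a ≤ j ∘ σ := by
  intro t
  -- Pigeonhole: otherwise σ would inject the indices ≤ t into the indices < t.
  obtain ⟨t', ht', hσt⟩ : ∃ t' ≤ t, t ≤ σ t' := by
    by_contra! h
    have := Finset.card_le_card_of_injOn (s := Finset.Iic t) (t := Finset.Iio t) σ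
      (fun x hx => by simpa using h x (by simpa using hx)) σ.injective.injOn
    simp at this
  exact (ha.monotone hσt).trans ((haj _).trans (hσ ht'))

/-- Sorting preserves the sum of the entries, so if j sorted to a, then a ≤ j with equal sums would
force j = a. -/
theorem lt_comp_of_strictMono {a j : Fin m → Fin n} (ha : StrictMono a) (haj : a ≤ j)
    (hne : j ≠ a) {σ : Equiv.Perm (Fin m)} (hσ : Monotone (j ∘ σ)) : a < j ∘ σ := by
  refine lt_of_le_of_ne (le_comp_of_strictMono ha haj hσ) fun h => hne ?_
  have hsum : ∑ t, (a t : ℕ) = ∑ t, (j t : ℕ) := by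
    rw [← Equiv.sum_comp σ fun t => (j t : ℕ), h]
    rfl
  have := (Finset.sum_eq_sum_iff_of_le fun t _ => Fin.le_def.1 (haj t)).1 hsum
  exact funext fun t => (Fin.ext (this t (Finset.mem_univ t))).symm

variable (k n m) in
/-- The `s`-th monomial in the `θ_i`. -/
noncomputable def thetaMon (s : Fin (n.choose m)) : ExteriorAlgebra k (Fin n → k) :=
  thetaProd k (ofLex (monIndex n m s).1)

theorem thetaProd_of_injective {j : Fin m → Fin n} (hj : Function.Injective j) :
    ∃ (r : Fin (n.choose m)) (c : k), (monIndex n m r).1 = toLex (j ∘ Tuple.sort j) ∧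
      thetaProd k j = c • thetaMon k n m r := by
  have hmono : StrictMono (j ∘ Tuple.sort j) :=
    (Tuple.monotone_sort j).strictMono_of_injective (hj.comp (Tuple.sort j).injective)
  have h : (monIndex n m ((monIndex n m).symm ⟨toLex (j ∘ Tuple.sort j), hmono⟩)).1 =
      toLex (j ∘ Tuple.sort j) := by rw [OrderIso.apply_symm_apply]
  refine ⟨(monIndex n m).symm ⟨toLex (j ∘ Tuple.sort j), hmono⟩,
    ((Equiv.Perm.sign (Tuple.sort j) : ℤ) : k), h, ?_⟩
  rw [thetaMon, h]
  exact thetaProd_sort j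

theorem thetaProd_of_le {s : Fin (n.choose m)} {j : Fin m → Fin n} (hj : Function.Injective j)
    (hle : ofLex (monIndex n m s).1 ≤ j) (hne : j ≠ ofLex (monIndex n m s).1) :
    ∃ (r : Fin (n.choose m)) (c : k), s < r ∧ thetaProd k j = c • thetaMon k n m r := by
  obtain ⟨r, c, hr, h⟩ := thetaProd_of_injective (k := k) hj
  refine ⟨r, c, ?_, h⟩
  rw [← (monIndex n m).lt_iff_lt, ← Subtype.coe_lt_coe, hr]
  exact Pi.toLex_strictMono (lt_comp_of_strictMono (monIndex n m s).2 hle hne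
    (Tuple.monotone_sort j))

theorem thetaMon_injective {r s : Fin (n.choose m)}
    (h : ofLex (monIndex n m r).1 = ofLex (monIndex n m s).1) : r = s :=
  (monIndex n m).injective (Subtype.ext (ofLex.injective h))

variable (k) in
/-- The coordinate of the `s`-th monomial in the `θ_i`. -/
theorem exists_coord (s : Fin (n.choose m)) :
    ∃ c : ExteriorAlgebra k (Fin n → k) →ₗ[k] k,
      c (thetaMon k n m s) = 1 ∧ ∀ r, r ≠ s → c (thetaMon k n m r) = 0 := by
  let f : Fin n → Module.Dual k (Fin n → k) := fun i => LinearMap.proj i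
  let x : Fin n → Fin n → k := fun i => Pi.single i 1
  let emb : Fin (n.choose m) → (Fin m ↪o Fin n) := fun r =>
    OrderEmbedding.ofStrictMono (ofLex (monIndex n m r).1) (monIndex n m r).2
  -- The coordinate is the pairing with the s-th monomial of the dual basis in degree m;
  -- `Function.update 0 m α` extends it by zero to all other degrees.
  let α := (exteriorPower.pairingDual k (Fin n → k) m
    (exteriorPower.ιMulti k m (f ∘ emb s))).compAlternatingMap (exteriorPower.ιMulti k m)
  have hα : ∀ r, ExteriorAlgebra.liftAlternating (Function.update 0 m α) (thetaMon k n m r) =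
      exteriorPower.pairingDual k (Fin n → k) m (exteriorPower.ιMulti k m (f ∘ emb s))
        (exteriorPower.ιMulti k m (x ∘ emb r)) := fun r => by
    rw [thetaMon, thetaProd, ExteriorAlgebra.liftAlternating_apply_ιMulti, Function.update_self]
    rfl
  have h₀ : ∀ ⦃i j⦄, i ≠ j → f i (x j) = 0 := fun i j hij => by simp [f, x, hij]
  refine ⟨ExteriorAlgebra.liftAlternating (Function.update 0 m α), ?_, fun r hr => ?_⟩
  · rw [hα]
    exact exteriorPower.pairingDual_apply_apply_eq_one x f (fun i => by simp [f, x]) h₀ _ _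
  · rw [hα]
    refine exteriorPower.pairingDual_apply_apply_eq_one_zero x f h₀ _ _ _ fun h => hr ?_
    exact (thetaMon_injective (funext fun t => DFunLike.congr_fun h t)).symm

end Monomials

/-! ### Unitriangularity of the ω-monomials in the θ-monomials. -/

section Triangularity

variable {k : Type*} [CommRing k] {n m : ℕ}

/-- The leading term of z^d ω_{i+d} is θ_i. In z^d ω_{j-1} = z^{d+1} ω_j + x_j z^d ω_j it comes from
the first summand; the second starts one index later. -/
theorem zTensor_expansion (m d : ℕ) (i : Fin n) (h : (i : ℕ) + m + d + 1 = n) :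
    ∃ c : Fin n → NilHecke k n, zTensor k n m d = ∑ j, theta k n j ⊗ₜ[k] c j ∧
      c i = 1 ∧ ∀ j < i, c j = 0 := by
  induction m generalizing d i with
  | zero =>
    refine ⟨Pi.single i 1, ?_, by simp, fun j hj => by simp [hj.ne]⟩
    rw [zTensor, zTheta, dif_pos (by omega), Finset.sum_eq_single i]
    · rw [Pi.single_eq_same]
      congr 2
      ext
      simp only
      omega
    · intro j _ hj
      simp [hj]
    · simp
  | succ m ih =>
    obtain ⟨c, hc, hci, hcj⟩ := ih (d + 1) i (by omega)
    obtain ⟨c', hc', hci', hcj'⟩ := ih d ⟨i + 1, by omega⟩ (by simp only; omega)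
    refine ⟨fun j => c j + nhX k n (n - 1 - m) * c' j, ?_, ?_, fun j hj => ?_⟩
    · rw [zTensor, hc, hc', Finset.mul_sum, ← Finset.sum_add_distrib]
      refine Finset.sum_congr rfl fun j _ => ?_
      rw [Algebra.TensorProduct.tmul_mul_tmul, one_mul, TensorProduct.tmul_add]
    · simp only
      rw [hci, hcj' i (Fin.lt_def.2 (by simp)), mul_zero, add_zero]
    · simp only
      rw [hcj j hj, hcj' j (hj.trans (Fin.lt_def.2 (by simp))), mul_zero, add_zero]

variable (k n) in
theorem exists_coefficients : ∃ c : Fin n → Fin n → NilHecke k n,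
    (∀ i, toExt k n (omegaA k i) = ∑ j, theta k n j ⊗ₜ[k] c i j) ∧
      (∀ i, c i i = 1) ∧ ∀ i, ∀ j < i, c i j = 0 := by
  choose c hc using fun i : Fin n =>
    zTensor_expansion (k := k) (n - 1 - i) 0 i (by omega)
  exact ⟨c, fun i => (toExt_omegaA i).trans (hc i).1, fun i => (hc i).2.1, fun i => (hc i).2.2⟩

theorem prod_ofFn_tmul {A B : Type*} [Ring A] [Ring B] [Algebra k A] [Algebra k B] {m : ℕ}
    (a : Fin m → A) (b : Fin m → B) :
    (List.ofFn fun t => a t ⊗ₜ[k] b t).prod = (List.ofFn a).prod ⊗ₜ[k] (List.ofFn b).prod := by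
  induction m with
  | zero => simp [Algebra.TensorProduct.one_def]
  | succ m ih => simp [List.ofFn_succ, ih]

theorem prod_ofFn_sum {A ι : Type*} [Ring A] [Algebra k A] [Fintype ι] {m : ℕ}
    (a : Fin m → ι → A) :
    (List.ofFn fun t => ∑ j, a t j).prod = ∑ f : Fin m → ι, (List.ofFn fun t => a t (f t)).prod := by
  classical
  simpa using (MultilinearMap.mkPiAlgebraFin k m A).map_sum a

variable (k n m) in
/-- The span of the elements `θ_r b` with `b ∈ nh_n`, for the monomials from the `j`-th on
(counted from `1`). -/
noncomputable def thetaSpan (j : ℕ) : Submodule k (Enhanced k n) :=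
  Submodule.span k {v | ∃ r : Fin (n.choose m), j ≤ (r : ℕ) + 1 ∧
    ∃ b : NilHecke k n, v = extToEnhanced k n (thetaMon k n m r) * nhToEnhanced k n b}

variable (k n m) in
/-- The span of the elements `ω_r b` with `b ∈ nh_n`, for the monomials from the `j`-th on
(counted from `1`). -/
noncomputable def omegaSpan (j : ℕ) : Submodule k (Enhanced k n) :=
  Submodule.span k {v | ∃ r : Fin (n.choose m), j ≤ (r : ℕ) + 1 ∧
    ∃ b : NilHecke k n, v = omegaMon k n m r * nhToEnhanced k n b}

theorem thetaMon_mul_mem {j : ℕ} {r : Fin (n.choose m)} (h : j ≤ (r : ℕ) + 1)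
    (b : NilHecke k n) :
    extToEnhanced k n (thetaMon k n m r) * nhToEnhanced k n b ∈ thetaSpan k n m j :=
  Submodule.subset_span ⟨r, h, b, rfl⟩

theorem thetaSpan_mono {i j : ℕ} (h : i ≤ j) : thetaSpan k n m j ≤ thetaSpan k n m i :=
  Submodule.span_mono fun _ ⟨r, hr, b, hb⟩ => ⟨r, h.trans hr, b, hb⟩

theorem thetaSpan_mul {j : ℕ} {v : Enhanced k n} (hv : v ∈ thetaSpan k n m j)
    (b : NilHecke k n) : v * nhToEnhanced k n b ∈ thetaSpan k n m j := by
  induction hv using Submodule.span_induction with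
  | mem v hv =>
    obtain ⟨r, hr, c, rfl⟩ := hv
    rw [mul_assoc, ← map_mul]
    exact thetaMon_mul_mem hr _
  | zero => rw [zero_mul]; exact zero_mem _
  | add v w _ _ hv hw => rw [add_mul]; exact add_mem hv hw
  | smul c v _ hv => rw [smul_mul_assoc]; exact Submodule.smul_mem _ _ hv

/-- The advantage of the θ's: they commute with `nh_n`, so left factors move to the right without
changing the monomial. -/
theorem mul_thetaSpan {j : ℕ} {v : Enhanced k n} (hv : v ∈ thetaSpan k n m j)
    (b : NilHecke k n) : nhToEnhanced k n b * v ∈ thetaSpan k n m j := by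
  induction hv using Submodule.span_induction with
  | mem v hv =>
    obtain ⟨r, hr, c, rfl⟩ := hv
    rw [← mul_assoc, ← (extToEnhanced_commute _ b).eq, mul_assoc, ← map_mul]
    exact thetaMon_mul_mem hr _
  | zero => rw [mul_zero]; exact zero_mem _
  | add v w _ _ hv hw => rw [mul_add]; exact add_mem hv hw
  | smul c v _ hv => rw [mul_smul_comm]; exact Submodule.smul_mem _ _ hv

/-- The monomials in the `ω_i` are unitriangular in the monomials in the `θ_i`. -/
theorem omegaMon_sub_mem (s : Fin (n.choose m)) :
    omegaMon k n m s - extToEnhanced k n (thetaMon k n m s) ∈ thetaSpan k n m (s + 2) := by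
  classical
  obtain ⟨c, hc, hc1, hc0⟩ := exists_coefficients k n
  set a := ofLex (monIndex n m s).1 with ha
  have h : omegaMon k n m s = ∑ f : Fin m → Fin n, extToEnhanced k n (thetaProd k f) *
      nhToEnhanced k n (List.ofFn fun t => c (a t) (f t)).prod := by
    apply (extEquiv k n).injective
    rw [extEquiv_apply, extEquiv_apply, omegaMon, map_list_prod, List.map_ofFn, map_sum]
    simp only [Function.comp_def, hc]
    rw [prod_ofFn_sum (k := k)]
    refine Finset.sum_congr rfl fun f _ => ?_
    rw [prod_ofFn_tmul, ← thetaProd_eq, ← ofExt_tmul, ← extEquiv_symm_apply, ← extEquiv_apply,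
      AlgEquiv.apply_symm_apply]
  have hone : (List.ofFn fun t => c (a t) (a t)).prod = 1 := by simp [hc1]
  rw [h, ← Finset.add_sum_erase _ _ (Finset.mem_univ a), hone, map_one, mul_one]
  rw [show thetaMon k n m s = thetaProd k a from rfl, add_sub_cancel_left]
  refine Submodule.sum_mem _ fun f hf => ?_
  by_cases hle : a ≤ f
  · by_cases hinj : Function.Injective f
    · obtain ⟨r, ε, hr, hf⟩ := thetaProd_of_le (k := k) hinj hle (Finset.ne_of_mem_erase hf)
      rw [hf, map_smul, smul_mul_assoc]
      exact Submodule.smul_mem _ _ (thetaMon_mul_mem (by have := Fin.lt_def.1 hr; omega) _)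
    · rw [thetaProd_eq_zero hinj, map_zero, zero_mul]
      exact zero_mem _
  · obtain ⟨t, ht⟩ : ∃ t, f t < a t := by simpa [Pi.le_def] using hle
    have : (List.ofFn fun t => c (a t) (f t)).prod = 0 :=
      List.prod_eq_zero (List.mem_ofFn.2 ⟨t, hc0 _ _ ht⟩)
    rw [this, map_zero, mul_zero]
    exact zero_mem _

theorem omegaMon_mul_mem {j : ℕ} {r : Fin (n.choose m)} (h : j ≤ (r : ℕ) + 1)
    (b : NilHecke k n) : omegaMon k n m r * nhToEnhanced k n b ∈ thetaSpan k n m j := by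
  have h1 := thetaSpan_mul (thetaSpan_mono (by omega : j ≤ r + 2) (omegaMon_sub_mem r)) b
  have h2 := add_mem h1 (thetaMon_mul_mem h b)
  rwa [sub_mul, sub_add_cancel] at h2

theorem omegaSpan_eq (j : ℕ) : omegaSpan k n m j = thetaSpan k n m j := by
  apply le_antisymm
  · refine Submodule.span_le.2 ?_
    rintro _ ⟨r, hr, b, rfl⟩
    exact omegaMon_mul_mem hr b
  · suffices ∀ (d : ℕ) (r : Fin (n.choose m)), n.choose m - r = d → j ≤ (r : ℕ) + 1 →
        ∀ b, extToEnhanced k n (thetaMon k n m r) * nhToEnhanced k n b ∈ omegaSpan k n m j by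
      refine Submodule.span_le.2 ?_
      rintro _ ⟨r, hr, b, rfl⟩
      exact this _ r rfl hr b
    intro d
    induction d using Nat.strong_induction_on with
    | _ d ih =>
    intro r hd hr b
    have h1 : thetaSpan k n m (r + 2) ≤ omegaSpan k n m j := by
      refine Submodule.span_le.2 ?_
      rintro _ ⟨r', hr', b, rfl⟩
      exact ih _ (by omega) r' rfl (by omega) b
    have h2 := h1 (thetaSpan_mul (omegaMon_sub_mem r) b)
    have h3 : omegaMon k n m r * nhToEnhanced k n b ∈ omegaSpan k n m j :=
      Submodule.subset_span ⟨r, hr, b, rfl⟩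
    have := sub_mem h3 h2
    rwa [sub_mul, sub_sub_cancel] at this

theorem thetaSpan_eq_bot : thetaSpan k n m (n.choose m + 1) = ⊥ := by
  rw [thetaSpan, Submodule.span_eq_bot]
  rintro _ ⟨r, hr, _⟩
  omega

theorem thetaProd_mul_mem (f : Fin m → Fin n) (b : NilHecke k n) :
    extToEnhanced k n (thetaProd k f) * nhToEnhanced k n b ∈ thetaSpan k n m 1 := by
  by_cases hinj : Function.Injective f
  · obtain ⟨r, ε, -, hf⟩ := thetaProd_of_injective (k := k) hinj
    rw [hf, map_smul, smul_mul_assoc]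
    exact Submodule.smul_mem _ _ (thetaMon_mul_mem (by omega) _)
  · rw [thetaProd_eq_zero hinj, map_zero, zero_mul]
    exact zero_mem _

theorem omegaA_mul_thetaSpan {v : Enhanced k n} (i : Fin n) (hv : v ∈ thetaSpan k n m 1) :
    omegaA k i * v ∈ thetaSpan k n (m + 1) 1 := by
  obtain ⟨c, hc, -, -⟩ := exists_coefficients k n
  have hω : omegaA k i = ∑ j, extToEnhanced k n (theta k n j) * nhToEnhanced k n (c i j) := by
    apply (extEquiv k n).injective
    rw [extEquiv_apply, hc, map_sum]
    refine Finset.sum_congr rfl fun j _ => ?_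
    rw [← ofExt_tmul, ← extEquiv_symm_apply, AlgEquiv.apply_symm_apply]
  induction hv using Submodule.span_induction with
  | mem v hv =>
    obtain ⟨r, hr, b, rfl⟩ := hv
    rw [hω, Finset.sum_mul]
    refine Submodule.sum_mem _ fun j _ => ?_
    rw [mul_assoc, ← mul_assoc (nhToEnhanced k n _), ← (extToEnhanced_commute _ _).eq,
      mul_assoc, ← map_mul, ← mul_assoc, ← map_mul, thetaMon, ← thetaProd_cons]
    exact thetaProd_mul_mem _ _
  | zero => rw [mul_zero]; exact zero_mem _
  | add v w _ _ hv hw => rw [mul_add]; exact add_mem hv hw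
  | smul c v _ hv => rw [mul_smul_comm]; exact Submodule.smul_mem _ _ hv

theorem prod_mem_thetaSpan (l : List (EGen n)) :
    (l.map (eGen k n)).prod ∈ thetaSpan k n (l.countP Sum.isRight) 1 := by
  induction l with
  | nil =>
    have := thetaProd_mul_mem (k := k) (n := n) (m := 0) Fin.elim0 1
    rwa [thetaProd_zero, map_one, map_one, mul_one] at this
  | cons g l ih =>
    rw [List.map_cons, List.prod_cons]
    rcases g with g | i
    · rw [List.countP_cons_of_neg (by simp), ← nhToEnhanced_nhGen]
      exact mul_thetaSpan ih _
    · rw [List.countP_cons_of_pos (by simp)]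
      exact omegaA_mul_thetaSpan i ih

theorem lambdaPiece_mul {v : Enhanced k n} (hv : v ∈ lambdaPiece k n m) (b : NilHecke k n) :
    v * nhToEnhanced k n b ∈ lambdaPiece k n m := by
  induction b using ringQuot_induction (k := k) generalizing v with
  | halg r =>
    rw [AlgHom.commutes, ← Algebra.commutes, ← Algebra.smul_def]
    exact Submodule.smul_mem _ _ hv
  | hgen g =>
    change v * nhToEnhanced k n (nhGen k n g) ∈ _
    rw [nhToEnhanced_nhGen]
    induction hv using Submodule.span_induction with
    | mem v hv =>
      obtain ⟨l, hl, rfl⟩ := hv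
      exact Submodule.subset_span ⟨l ++ [.inl g], by simp [hl], by simp⟩
    | zero => rw [zero_mul]; exact zero_mem _
    | add v w _ _ hv hw => rw [add_mul]; exact add_mem hv hw
    | smul c v _ hv => rw [smul_mul_assoc]; exact Submodule.smul_mem _ _ hv
  | hmul a b ha hb => rw [map_mul, ← mul_assoc]; exact hb (ha hv)
  | hadd a b ha hb => rw [map_add, mul_add]; exact add_mem (ha hv) (hb hv)

theorem omegaMon_mem_lambdaPiece (s : Fin (n.choose m)) :
    omegaMon k n m s ∈ lambdaPiece k n m := by
  refine Submodule.subset_span ⟨List.ofFn fun t => .inr (ofLex (monIndex n m s).1 t), ?_, ?_⟩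
  · rw [List.countP_eq_length.2 (by simp [List.mem_ofFn]), List.length_ofFn]
  · rw [List.map_ofFn]
    rfl

theorem thetaSpan_one : thetaSpan k n m 1 = lambdaPiece k n m := by
  apply le_antisymm
  · rw [← omegaSpan_eq]
    refine Submodule.span_le.2 ?_
    rintro _ ⟨r, -, b, rfl⟩
    exact lambdaPiece_mul (omegaMon_mem_lambdaPiece r) b
  · refine Submodule.span_le.2 ?_
    rintro _ ⟨l, rfl, rfl⟩
    exact prod_mem_thetaSpan l

end Triangularity

section Filtration

variable {k : Type*} [CommRing k] {n m : ℕ}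

theorem isSl2Stable_thetaSpan (ρ₀ : Sl2 k →ₗ⁅k⁆ Module.End k (NilHecke k n)) (j : ℕ) :
    IsSl2Stable (extendAction ρ₀) (thetaSpan k n m j) := by
  intro X v hv
  induction hv using Submodule.span_induction with
  | mem v hv =>
    obtain ⟨r, hr, b, rfl⟩ := hv
    rw [extendAction_apply, extendEnd_extToEnhanced_mul]
    exact thetaMon_mul_mem hr _
  | zero => rw [map_zero]; exact zero_mem _
  | add v w _ _ hv hw => rw [map_add]; exact add_mem hv hw
  | smul c v _ hv => rw [map_smul]; exact Submodule.smul_mem _ _ hv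

theorem filtGE_extendAction (ρ₀ : Sl2 k →ₗ⁅k⁆ Module.End k (NilHecke k n)) (j : ℕ) :
    filtGE (extendAction ρ₀) m j = thetaSpan k n m j := by
  apply le_antisymm
  · refine sInf_le ⟨isSl2Stable_thetaSpan ρ₀ j, fun r hr a b => ?_⟩
    rw [mul_assoc]
    exact mul_thetaSpan (omegaMon_mul_mem hr b) a
  · rw [← omegaSpan_eq]
    refine le_sInf fun N hN => Submodule.span_le.2 ?_
    rintro _ ⟨r, hr, b, rfl⟩
    simpa using hN.2 r hr 1 b

/-- The coordinate `A_n → nh_n` along a linear form on the exterior algebra. -/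
noncomputable def coordA (c : ExteriorAlgebra k (Fin n → k) →ₗ[k] k) :
    Enhanced k n →ₗ[k] NilHecke k n :=
  (TensorProduct.lid k (NilHecke k n)).toLinearMap ∘ₗ
    LinearMap.rTensor (NilHecke k n) c ∘ₗ (extEquiv k n).toLinearMap

theorem coordA_mul (c : ExteriorAlgebra k (Fin n → k) →ₗ[k] k)
    (a : ExteriorAlgebra k (Fin n → k)) (b : NilHecke k n) :
    coordA c (extToEnhanced k n a * nhToEnhanced k n b) = c a • b := by
  rw [← ofExt_tmul, ← extEquiv_symm_apply]
  simp [coordA]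

theorem coordA_extendEnd (c : ExteriorAlgebra k (Fin n → k) →ₗ[k] k)
    (D : Module.End k (NilHecke k n)) (v : Enhanced k n) :
    coordA c (extendEnd D v) = D (coordA c v) := by
  obtain ⟨t, rfl⟩ := (extEquiv k n).symm.surjective v
  induction t using TensorProduct.induction_on with
  | zero => simp
  | add t t' h h' => simp only [map_add, h, h']
  | tmul a b =>
    rw [extEquiv_symm_apply, ofExt_tmul, extendEnd_extToEnhanced_mul, coordA_mul, coordA_mul,
      map_smul]

theorem coordA_eq_zero {s : Fin (n.choose m)} {c : ExteriorAlgebra k (Fin n → k) →ₗ[k] k}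
    (hc : ∀ r, r ≠ s → c (thetaMon k n m r) = 0) {v : Enhanced k n}
    (hv : v ∈ thetaSpan k n m (s + 2)) : coordA c v = 0 := by
  induction hv using Submodule.span_induction with
  | mem v hv =>
    obtain ⟨r, hr, b, rfl⟩ := hv
    rw [coordA_mul, hc r (by rintro rfl; omega), zero_smul]
  | zero => rw [map_zero]
  | add v w _ _ hv hw => rw [map_add, hv, hw, add_zero]
  | smul c v _ hv => rw [map_smul, hv, smul_zero]

theorem sub_coordA_mem {s : Fin (n.choose m)} {c : ExteriorAlgebra k (Fin n → k) →ₗ[k] k}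
    (hcs : c (thetaMon k n m s) = 1) (hc : ∀ r, r ≠ s → c (thetaMon k n m r) = 0)
    {v : Enhanced k n} (hv : v ∈ thetaSpan k n m (s + 1)) :
    v - extToEnhanced k n (thetaMon k n m s) * nhToEnhanced k n (coordA c v) ∈
      thetaSpan k n m (s + 2) := by
  induction hv using Submodule.span_induction with
  | mem v hv =>
    obtain ⟨r, hr, b, rfl⟩ := hv
    rw [coordA_mul]
    by_cases hrs : r = s
    · rw [hrs, hcs, one_smul, sub_self]
      exact zero_mem _
    · rw [hc r hrs, zero_smul, map_zero, mul_zero, sub_zero]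
      have : (r : ℕ) ≠ s := fun h => hrs (Fin.ext h)
      exact thetaMon_mul_mem (by omega) b
  | zero => simp
  | add v w _ _ hv hw =>
    have := add_mem hv hw
    rwa [sub_add_sub_comm, ← mul_add, ← map_add, ← map_add] at this
  | smul r v _ hv =>
    have := Submodule.smul_mem _ r hv
    rwa [smul_sub, ← mul_smul_comm, ← map_smul, ← map_smul] at this

theorem omegaLine_eq (s : Fin (n.choose m)) :
    omegaLine k n m s = Submodule.span k {thetaMon k n m s} := by
  rw [thetaMon, thetaProd_eq]
  rfl

/-- The successive quotients of the filtration. -/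
theorem exists_quotient_equiv (ρ₀ : Sl2 k →ₗ⁅k⁆ Module.End k (NilHecke k n))
    (s : Fin (n.choose m)) {N N' : Submodule k (Enhanced k n)}
    (hN : N = thetaSpan k n m (s + 1)) (hN' : N' = thetaSpan k n m (s + 2)) :
    ∃ φ : (N ⧸ N'.submoduleOf N) ≃ₗ[k] (omegaLine k n m s ⊗[k] NilHecke k n),
      ∀ (X : Sl2 k) (v w : N), (w : Enhanced k n) = extendAction ρ₀ X v →
        φ (Submodule.Quotient.mk w) =
          LinearMap.lTensor (omegaLine k n m s) (ρ₀ X) (φ (Submodule.Quotient.mk v)) := by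
  subst hN hN'
  obtain ⟨c, hcs, hc⟩ := exists_coord k s
  have hmem : thetaMon k n m s ∈ omegaLine k n m s := by
    rw [omegaLine_eq]
    exact Submodule.mem_span_singleton_self _
  let γ : omegaLine k n m s := ⟨thetaMon k n m s, hmem⟩
  let g : thetaSpan k n m (s + 1) →ₗ[k] omegaLine k n m s ⊗[k] NilHecke k n :=
    TensorProduct.mk k _ _ γ ∘ₗ coordA c ∘ₗ (thetaSpan k n m (s + 1)).subtype
  have hg : ∀ v, g v = γ ⊗ₜ[k] coordA c (v : Enhanced k n) := fun v => rfl
  have hsurj : Function.Surjective g := by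
    intro t
    induction t with
    | zero => exact ⟨0, map_zero _⟩
    | add t t' h h' =>
      obtain ⟨v, rfl⟩ := h
      obtain ⟨w, rfl⟩ := h'
      exact ⟨v + w, map_add _ _ _⟩
    | tmul x b =>
      obtain ⟨x, hx⟩ := x
      have hx' := hx
      rw [omegaLine_eq] at hx'
      obtain ⟨r, rfl⟩ := Submodule.mem_span_singleton.1 hx'
      refine ⟨⟨extToEnhanced k n (thetaMon k n m s) * nhToEnhanced k n (r • b),
        thetaMon_mul_mem le_rfl _⟩, ?_⟩
      rw [hg, coordA_mul, hcs, one_smul, ← TensorProduct.smul_tmul]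
      rfl
  have hzero : ∀ b : NilHecke k n, γ ⊗ₜ[k] b = 0 → b = 0 := by
    intro b hb
    have := congrArg (TensorProduct.lid k (NilHecke k n) ∘
      LinearMap.rTensor (NilHecke k n) (c ∘ₗ (omegaLine k n m s).subtype)) hb
    simpa [γ, hcs] using this
  have hker : LinearMap.ker g =
      (thetaSpan k n m (s + 2)).submoduleOf (thetaSpan k n m (s + 1)) := by
    ext v
    rw [LinearMap.mem_ker, hg]
    change _ ↔ (v : Enhanced k n) ∈ thetaSpan k n m (s + 2)
    constructor
    · intro hv
      have := sub_coordA_mem hcs hc v.2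
      rwa [hzero _ hv, map_zero, mul_zero, sub_zero] at this
    · intro hv
      rw [coordA_eq_zero hc hv, TensorProduct.tmul_zero]
  let φ := (Submodule.quotEquivOfEq _ _ hker.symm).trans (g.quotKerEquivOfSurjective hsurj)
  have hφ : ∀ v, φ (Submodule.Quotient.mk v) = g v := fun v => rfl
  refine ⟨φ, fun X v w hw => ?_⟩
  rw [hφ, hφ, hg, hg, hw, LinearMap.lTensor_tmul, extendAction_apply, coordA_extendEnd]

end Filtration

end EnhancedNilHecke

theorem proposition4p2 (k : Type*) [CommRing k] (n : ℕ) :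
    ∃ (ρ₀ : Sl2 k →ₗ⁅k⁆ Module.End k (NilHecke k n))
      (ρ : Sl2 k →ₗ⁅k⁆ Module.End k (Enhanced k n)),
      -- the prescribed values define a unique action on the nilHecke algebra and on `A_n`
      (IsNilHeckeAction ρ₀ ∧ ∀ ρ', IsNilHeckeAction ρ' → ρ' = ρ₀) ∧
      (IsEnhancedAction ρ ∧ ∀ ρ', IsEnhancedAction ρ' → ρ' = ρ) ∧
      ∀ m ≤ n,
        IsSl2Stable ρ (lambdaPiece k n m) ∧
        -- each step of the filtration is a submodule, spanned by `ω_r nh_n` for `r ≥ j`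
        (∀ j, IsSl2Stable ρ (filtGE ρ m j) ∧
          filtGE ρ m j = Submodule.span k
            {v | ∃ r : Fin (n.choose m), j ≤ (r : ℕ) + 1 ∧
              ∃ b : NilHecke k n, v = omegaMon k n m r * nhToEnhanced k n b}) ∧
        (∀ j, filtGE ρ m (j + 1) ≤ filtGE ρ m j) ∧
        filtGE ρ m 1 = lambdaPiece k n m ∧
        filtGE ρ m (n.choose m + 1) = ⊥ ∧
        -- successive quotients, for the monomial with number `s + 1`
        ∀ s : Fin (n.choose m),
          ∃ φ : (filtGE ρ m (s + 1) ⧸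
                (filtGE ρ m (s + 2)).submoduleOf (filtGE ρ m (s + 1))) ≃ₗ[k]
              (omegaLine k n m s ⊗[k] NilHecke k n),
            ∀ (X : Sl2 k) (v w : filtGE ρ m (s + 1)),
              (w : Enhanced k n) = ρ X v →
                φ (Submodule.Quotient.mk w) =
                  LinearMap.lTensor (omegaLine k n m s) (ρ₀ X) (φ (Submodule.Quotient.mk v)) := by
  obtain ⟨ρ₀, hρ₀⟩ := exists_isNilHeckeAction k n
  have hρ := isEnhancedAction_extendAction hρ₀
  refine ⟨ρ₀, extendAction ρ₀, ⟨hρ₀, fun ρ' h => h.unique hρ₀⟩, ⟨hρ, fun ρ' h => h.unique hρ⟩,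
    fun m _ => ⟨?_, fun j => ⟨?_, ?_⟩, fun j => ?_, ?_, ?_, fun s => ?_⟩⟩
  · rw [← thetaSpan_one]
    exact isSl2Stable_thetaSpan ρ₀ 1
  · rw [filtGE_extendAction]
    exact isSl2Stable_thetaSpan ρ₀ j
  · rw [filtGE_extendAction]
    exact (omegaSpan_eq j).symm
  · rw [filtGE_extendAction, filtGE_extendAction]
    exact thetaSpan_mono (Nat.le_succ j)
  · rw [filtGE_extendAction, thetaSpan_one]
  · rw [filtGE_extendAction, thetaSpan_eq_bot]
  · exact exists_quotient_equiv ρ₀ s (filtGE_extendAction ρ₀ _) (filtGE_extendAction ρ₀ _)
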